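/- Let $\mathfrak g=\mathfrak{sl}_{n+1}(\mathbb C)=\mathfrak n^-\oplus\mathfrak h\oplus\mathfrak n^+$ with simple roots $\alpha_1,\dots,\alpha_n$, positive roots $R^+=\{\alpha_i+\cdots+\alpha_j: 1\le i\le j\le n\}$, root vectors $x_\alpha^\pm$ of weight $\pm\alpha$ and coroots $h_\alpha$ ($\alpha\in R^+$); write $x_i^\pm=x_{\alpha_i}^\pm$, $h_i=h_{\alpha_i}$. For $\alpha,\beta\in R^+$ write $\beta\succeq\alpha$ if $\beta-\alpha\in\sum_i\mathbb Z_{\ge0}\alpha_i$. Let $\mathfrak a[t]=\mathfrak a\otimes\mathbb C[t]$, $\mathbf U=U(\mathfrak g[t])$ and $\mathbf U^-=U(\mathfrak n^-[t])$. Let $\lambda$ be a dominant integral weight, $\lambda_i=\lambda(h_i)$, and let $\boldsymbol\xi=(\xi_\alpha)_{\alpha\in R^+}$ be a tuple of non-negative integers such that $\xi_\alpha\ge 1$ whenever $\lambda(h_\alpha)>0$. Let $\mathcal I_{\boldsymbol\xi,\lambda}\subseteq\mathbf U$ be the left ideal generated by $$\mathfrak n^+[t],\quad h_i\otimes t^r\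 (r\ge1),\quad h_i-\lambda_i\cdot 1,\quad (x_i^-\otimes 1)^{\lambda_i+1}\quad(1\le i\le n),\qquad x_\alpha^-\otimes t^{\xi_\alpha}\quad(\alpha\in R^+),$$ and put $\mathcal J_{\boldsymbol\xi,\lambda}=\mathcal I_{\boldsymbol\xi,\lambda}\cap\mathbf U^-$. Let $W(\lambda)$ be the local Weyl module, that is, the quotient of $\mathbf U$ by the left ideal generated by the elements of this list other than the $x_\alpha^-\otimes t^{\xi_\alpha}$, let $w_\lambda$ be the image of $1$, and let $M_{\boldsymbol\xi,\lambda}$ be the quotient of $W(\lambda)$ by the submodule generated by the vectors $(x^-_\alpha\otimes t^{\xi_\alpha})w_\lambda$, $\alpha\in R^+$. For $r,s\ge 0$ let $$\mathbf x_i^-(r,s)=\sum \frac{(x_i^-\otimes 1)^{b_0}}{b_0!}\cdots\frac{(x_i^-\otimes t^s)^{b_s}}{b_s!},$$ where the sum runs over all tuples $(b_0,\dots,b_s)$ of non-negative integers with $\sum_j b_j=r$ and $\sum_j jb_j=s$. Then $\mathcal J_{\boldsymbol\xi,\lambda}$ is the annihilator in $\mathbf U^-$ of the image of $w_\lambda$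 in $M_{\boldsymbol\xi,\lambda}$, and it is the left ideal of $\mathbf U^-$ generated by the elements $$\mathbf x_i^-(r,s),\quad 1\le i\le n,\ r\ge1,\ s\ge0,\ r+s\ge 1+\lambda_i,$$ $$x^-_\alpha\otimes t^k,\quad \alpha\in R^+,\ k\ge\min\{\xi_\beta:\beta\succeq\alpha\}.$$ -/

import Mathlib

open scoped TensorProduct Polynomial

noncomputable section

namespace CurrentSl

/-- The simple Lie algebra `𝔤 = 𝔰𝔩_{n+1}(ℂ)`; its simple roots are indexed by `Fin n`. -/
abbrev G (n : ℕ) : Type := LieAlgebra.SpecialLinear.sl (Fin (n + 1)) ℂ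

/-! ### Positive roots -/

/-- A positive root `α_{i,j} = α_i + ⋯ + α_j`, `i ≤ j`, of `𝔰𝔩_{n+1}`, given by the pair `(i, j)`. -/
abbrev PosRoot (n : ℕ) : Type := {p : Fin n × Fin n // p.1 ≤ p.2}

/-- The simple root `α_i = α_{i,i}`. -/
def simpleRoot {n : ℕ} (i : Fin n) : PosRoot n := ⟨(i, i), le_rfl⟩

/-- The coefficients of a positive root in the basis of simple roots. -/
def PosRoot.coeff {n : ℕ} (α : PosRoot n) (k : Fin n) : ℕ :=
  if α.1.1 ≤ k ∧ k ≤ α.1.2 then 1 else 0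

/-- The root order: `β ⪰ α` means that `β - α` is a combination of the simple roots with
non-negative integer coefficients. -/
def PosRoot.Dominates {n : ℕ} (β α : PosRoot n) : Prop := ∀ k, α.coeff k ≤ β.coeff k

instance {n : ℕ} (β α : PosRoot n) : Decidable (β.Dominates α) :=
  inferInstanceAs (Decidable (∀ k, α.coeff k ≤ β.coeff k))

/-- `min {ξ_β : β ⪰ α}`, a minimum over a finite set that contains `α`. -/
def minAbove {n : ℕ} (ξ : PosRoot n → ℕ) (α : PosRoot n) : ℕ :=
  (Finset.univ.filter fun β : PosRoot n => β.Dominates α).inf'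
    ⟨α, Finset.mem_filter.mpr ⟨Finset.mem_univ α, fun _ => le_rfl⟩⟩ ξ

/-- The value `λ(h_α)` of a weight `λ = ∑ λ_k ϖ_k` at the coroot `h_α`; in type `A` the
coroot of `α_i + ⋯ + α_j` is `h_i + ⋯ + h_j`. -/
def corootValue {n : ℕ} (lam : Fin n → ℕ) (α : PosRoot n) : ℕ := ∑ k, α.coeff k * lam k

/-! ### Root vectors, coroots and the nilpotent subalgebras -/

/-- The subalgebra `𝔫⁻` of strictly lower triangular matrices. -/
def nMinus (n : ℕ) : LieSubalgebra ℂ (G n) where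
  carrier := {A | ∀ a b, a ≤ b → A.val a b = 0}
  add_mem' {A B} hA hB a b hab := by
    change A.val a b + B.val a b = 0
    rw [hA a b hab, hB a b hab, add_zero]
  zero_mem' _ _ _ := rfl
  smul_mem' c A hA a b hab := by
    change c * A.val a b = 0
    rw [hA a b hab, mul_zero]
  lie_mem' {A B} hA hB a b hab := by
    have key : ∀ C D : G n, (∀ a b, a ≤ b → C.val a b = 0) → (∀ a b, a ≤ b → D.val a b = 0) →
        (C.val * D.val) a b = 0 := by
      intro C D hC hD
      rw [Matrix.mul_apply]
      refine Finset.sum_eq_zero fun k _ => ?_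
      rcases le_total a k with h | h
      · rw [hC a k h, zero_mul]
      · rw [hD k b (h.trans hab), mul_zero]
    rw [LieAlgebra.SpecialLinear.sl_bracket, Matrix.sub_apply, key A B hA hB, key B A hB hA,
      sub_zero]

/-- The subalgebra `𝔫⁺` of strictly upper triangular matrices. -/
def nPlus (n : ℕ) : LieSubalgebra ℂ (G n) where
  carrier := {A | ∀ a b, b ≤ a → A.val a b = 0}
  add_mem' {A B} hA hB a b hab := by
    change A.val a b + B.val a b = 0
    rw [hA a b hab, hB a b hab, add_zero]
  zero_mem' _ _ _ := rfl
  smul_mem' c A hA a b hab := by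
    change c * A.val a b = 0
    rw [hA a b hab, mul_zero]
  lie_mem' {A B} hA hB a b hab := by
    have key : ∀ C D : G n, (∀ a b, b ≤ a → C.val a b = 0) → (∀ a b, b ≤ a → D.val a b = 0) →
        (C.val * D.val) a b = 0 := by
      intro C D hC hD
      rw [Matrix.mul_apply]
      refine Finset.sum_eq_zero fun k _ => ?_
      rcases le_total k a with h | h
      · rw [hC a k h, zero_mul]
      · rw [hD k b (hab.trans h), mul_zero]
    rw [LieAlgebra.SpecialLinear.sl_bracket, Matrix.sub_apply, key A B hA hB, key B A hB hA,
      sub_zero]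

/-- The negative root vector `x⁻_{i,j} = E_{j+1,i}` of weight `-α_{i,j}`, as an element of `𝔫⁻`. -/
def xMinus {n : ℕ} (α : PosRoot n) : nMinus n :=
  ⟨LieAlgebra.SpecialLinear.single α.1.2.succ α.1.1.castSucc
      (Fin.castSucc_lt_succ_iff.mpr α.2).ne' 1, by
    intro a b hab
    rw [LieAlgebra.SpecialLinear.val_single]
    refine Matrix.single_apply_of_ne _ _ _ _ _ ?_
    rintro ⟨rfl, rfl⟩
    exact absurd (Fin.castSucc_lt_succ_iff.mpr α.2) (not_lt.mpr hab)⟩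

/-- The simple coroot `h_i = E_{i,i} - E_{i+1,i+1}`. -/
def coroot {n : ℕ} (i : Fin n) : G n :=
  LieAlgebra.SpecialLinear.singleSubSingle i.castSucc i.succ 1

/-! ### Current algebras and their universal enveloping algebras -/

/-- The current algebra `𝔞[t] = ℂ[t] ⊗ 𝔞` of a complex Lie algebra `𝔞`. -/
abbrev Current (L : Type) [LieRing L] [LieAlgebra ℂ L] : Type := ℂ[X] ⊗[ℂ] L

/-- The element `x ⊗ t^r` of `𝔞[t]`. -/
def cur {L : Type} [LieRing L] [LieAlgebra ℂ L] (x : L) (r : ℕ) : Current L :=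
  (Polynomial.X ^ r : ℂ[X]) ⊗ₜ[ℂ] x

/-- `𝐔 = U(𝔤[t])`. -/
abbrev U (n : ℕ) : Type := UniversalEnvelopingAlgebra ℂ (Current (G n))

/-- `𝐔⁻ = U(𝔫⁻[t])`. -/
abbrev UMinus (n : ℕ) : Type := UniversalEnvelopingAlgebra ℂ (Current (nMinus n))

attribute [local instance 100] LieRing.ofAssociativeRing

/-- The inclusion `𝔨[t] → 𝔤[t]`, `x ⊗ f ↦ x ⊗ f`, for a subalgebra `𝔨` of `𝔤`. -/
def currentIncl {n : ℕ} (k : LieSubalgebra ℂ (G n)) : Current k →ₗ⁅ℂ⁆ Current (G n) :=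
  LieAlgebra.ExtendScalars.map (AlgHom.id ℂ ℂ[X]) k.incl

/-- The canonical algebra map `𝐔⁻ → 𝐔` induced by `𝔫⁻[t] ⊆ 𝔤[t]`. -/
def inclU (n : ℕ) : UMinus n →ₐ[ℂ] U n :=
  UniversalEnvelopingAlgebra.lift ℂ
    ((UniversalEnvelopingAlgebra.ι ℂ).comp (currentIncl (nMinus n)))

/-- The element `x ⊗ t^r` of `𝐔`, for `x ∈ 𝔤`. -/
def elt {n : ℕ} (x : G n) (r : ℕ) : U n := UniversalEnvelopingAlgebra.ι ℂ (cur x r)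

/-- The element `x⁻_α ⊗ t^r` of `𝐔⁻`. -/
def xMinusT {n : ℕ} (α : PosRoot n) (r : ℕ) : UMinus n :=
  UniversalEnvelopingAlgebra.ι ℂ (cur (xMinus α) r)

/-- The divided power `x^{(r)} = x^r / r!`. -/
def dividedPow {A : Type} [Ring A] [Algebra ℂ A] (x : A) (r : ℕ) : A :=
  ((r.factorial : ℂ)⁻¹) • x ^ r

/-- `𝐱_i⁻(r, s) = ∑ (x_i⁻ ⊗ 1)^{(b_0)} ⋯ (x_i⁻ ⊗ t^s)^{(b_s)}`, the sum over all tuples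
`(b_0, …, b_s)` of non-negative integers with `∑ b_j = r` and `∑ j b_j = s`. -/
def garland {n : ℕ} (i : Fin n) (r s : ℕ) : UMinus n :=
  ∑ b ∈ (Finset.piAntidiag (Finset.univ : Finset (Fin (s + 1))) r).filter
      (fun b => ∑ j : Fin (s + 1), (j : ℕ) * b j = s),
    (List.ofFn fun j : Fin (s + 1) => dividedPow (xMinusT (simpleRoot i) j) (b j)).prod

/-! ### Local Weyl modules and truncated modules -/

/-- The defining relations of the local Weyl module `W(λ)`, `λ = ∑ λ_i ϖ_i`. -/
def weylRelations {n : ℕ} (lam : Fin n → ℕ) : Set (U n) :=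
  (Set.range fun y : Current (nPlus n) => UniversalEnvelopingAlgebra.ι ℂ (currentIncl (nPlus n) y)) ∪
  {u | ∃ (i : Fin n) (r : ℕ), 1 ≤ r ∧ u = elt (coroot i) r} ∪
  {u | ∃ i : Fin n, u = elt (coroot i) 0 - algebraMap ℂ (U n) (lam i : ℂ)} ∪
  {u | ∃ i : Fin n, u = elt (xMinus (simpleRoot i) : G n) 0 ^ (lam i + 1)}

/-- The local Weyl module `W(λ)`, a cyclic left `𝐔`-module. -/
abbrev LocalWeyl {n : ℕ} (lam : Fin n → ℕ) : Type :=
  U n ⧸ (Submodule.span (U n) (weylRelations lam))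

/-- The highest weight generator `w_λ` of `W(λ)`. -/
def weylGen {n : ℕ} (lam : Fin n → ℕ) : LocalWeyl lam := Submodule.Quotient.mk 1

/-- The truncated module `M_{ξ,λ}`: the quotient of `W(λ)` by the submodule generated by the
vectors `(x⁻_α ⊗ t^{ξ_α}) w_λ`. -/
abbrev TruncModule {n : ℕ} (ξ : PosRoot n → ℕ) (lam : Fin n → ℕ) : Type :=
  LocalWeyl lam ⧸ (Submodule.span (U n)
    (Set.range fun α : PosRoot n => elt (xMinus α : G n) (ξ α) • weylGen lam))

/-- The cyclic generator of `M_{ξ,λ}`, the image of `w_λ`. -/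
def truncGen {n : ℕ} (ξ : PosRoot n → ℕ) (lam : Fin n → ℕ) : TruncModule ξ lam :=
  Submodule.Quotient.mk (weylGen lam)

/-- The left ideal `𝓘_{ξ,λ}` of `𝐔`, given by its generators (`Ideal` means left ideal). -/
def idealI {n : ℕ} (ξ : PosRoot n → ℕ) (lam : Fin n → ℕ) : Ideal (U n) :=
  Ideal.span (weylRelations lam ∪
    Set.range fun α : PosRoot n => elt (xMinus α : G n) (ξ α))

/-- The left ideal `𝓙_{ξ,λ} = 𝓘_{ξ,λ} ∩ 𝐔⁻` of `𝐔⁻`. -/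
def idealJ {n : ℕ} (ξ : PosRoot n → ℕ) (lam : Fin n → ℕ) : Ideal (UMinus n) :=
  (idealI ξ lam).comap (inclU n)

end CurrentSl

end

open scoped TensorProduct Polynomial

noncomputable section

attribute [local instance 100] LieRing.ofAssociativeRing

/-! ### Modules induced from a character, realized on `U(N)` without a PBW theorem -/

namespace UniversalEnvelopingAlgebra

variable {R L N : Type*} [CommRing R] [LieRing L] [LieAlgebra R L] [LieRing N] [LieAlgebra R N]

/-! The idea is to let `𝐔` act on `𝐔⁻` as on the Verma module induced from the character of `(𝔥 ⊕
𝔫⁺)[t]` that kills `𝔫⁺[t]` and `h ⊗ t^r` for `r ≥ 1`, and sends `h_i` to `λ_i`. The action is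
defined recursively by its value on `1` and by `g·(yu) = y(g·u) + [g,y]·u`. Elements of `𝐔⁻` act by
left multiplication, so `u·1 = u`, and modulo `𝓘` the product `gu` in `𝐔` equals `g·u`. Hence `𝓙` is
stable under `𝔤[t]` (`mem_vermaStabilizer_idealJ`). Conversely, if a `𝔤[t]`-stable left ideal of
`𝐔⁻` contains the powers `(x_i⁻ ⊗ 1)^{λ_i+1}` and the `x_α⁻ ⊗ t^{ξ_α}`, then `v·1` lies in it for
every `v ∈ 𝓘`, so it contains `𝓙` (`vermaHom_one_mem`). Thus `𝓙` is the smallest such ideal, and the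
theorem is a statement about submodules of the Verma module.

The listed elements lie in `𝓙`: applying `x_i⁺ ⊗ t` repeatedly to powers of `x_i⁻ ⊗ 1` produces the
`𝐱_i⁻(r, s)` (`garland_mem_of_pow_mem`), while coroots raise the power of `t` and positive root
vectors pass from `β` to any `α ⪯ β` (`xMinusT_mem_of_minAbove_le`).

Their span is stable: only `h_i ⊗ t^r` and `x_i⁺ ⊗ 1` need testing, and only on generators
(`vermaStabilizer_span_eq_top`). On powers of the generating series `∑ (x_i⁻ ⊗ t^m) z^m` they act as
differential operators. The decisive scalar is `λ_i - r - s` in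
`verma_simpleRaising_zero_garlandCoeff`, which vanishes exactly where the image would leave the
list. On root vectors the only danger is `x_i⁺ · (x_i⁻ ⊗ 1) = λ_i`, which the condition on `ξ` makes
zero when `x_i⁻ ⊗ 1` is listed. -/

/-- A submodule of the enveloping algebra is a left ideal as soon as it is stable under left
multiplication by the Lie algebra. -/
theorem mul_mem_of_ι_mul_mem (M : Submodule R (UniversalEnvelopingAlgebra R N))
    (hM : ∀ (x : N), ∀ u ∈ M, ι R x * u ∈ M) (a : UniversalEnvelopingAlgebra R N)
    {u : UniversalEnvelopingAlgebra R N} (hu : u ∈ M) : a * u ∈ M := by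
  let S : Subalgebra R (UniversalEnvelopingAlgebra R N) :=
    { carrier := {a | ∀ u ∈ M, a * u ∈ M}
      mul_mem' := fun {a b} ha hb u hu => by rw [mul_assoc]; exact ha _ (hb _ hu)
      add_mem' := fun {a b} ha hb u hu => by rw [add_mul]; exact M.add_mem (ha _ hu) (hb _ hu)
      algebraMap_mem' := fun r u hu => by rw [← Algebra.smul_def]; exact M.smul_mem r hu }
  let f : N →ₗ⁅R⁆ S :=
    { toFun := fun x => ⟨ι R x, hM x⟩
      map_add' := fun x y => Subtype.ext (map_add _ x y)
      map_smul' := fun r x => Subtype.ext (map_smul _ r x)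
      map_lie' := fun {x y} => Subtype.ext (LieHom.map_lie (ι R) x y) }
  have h : S.val.comp (lift R f) = AlgHom.id R _ := by
    ext x
    simp only [LieHom.coe_comp, Function.comp_apply, AlgHom.coe_toLieHom, AlgHom.comp_apply,
      lift_ι_apply]
    rfl
  have ha : a ∈ S := by
    have := (lift R f a).2
    rwa [show ((lift R f a : S) : UniversalEnvelopingAlgebra R N) = a from
      DFunLike.congr_fun h a] at this
  exact ha u hu

/-- Induction on elements of the enveloping algebra by left multiplication by the Lie algebra. -/
theorem induction_ι_mul {P : UniversalEnvelopingAlgebra R N → Prop} (zero : P 0) (one : P 1)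
    (add : ∀ u v, P u → P v → P (u + v)) (smul : ∀ (r : R) u, P u → P (r • u))
    (mul : ∀ x u, P u → P (ι R x * u)) (u : UniversalEnvelopingAlgebra R N) : P u := by
  have := mul_mem_of_ι_mul_mem (N := N) (R := R)
    { carrier := {u | P u}, zero_mem' := zero, add_mem' := add _ _, smul_mem' := smul } mul u
    (u := 1) one
  simpa using this

/-- The action of `N` on the linear maps `L → U(N)`, for a Lie algebra map `N → L`. -/
def homAction (j : N →ₗ⁅R⁆ L) :
    N →ₗ⁅R⁆ Module.End R (L →ₗ[R] UniversalEnvelopingAlgebra R N) where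
  toFun x :=
    -- If `f` is the map `g ↦ g·u`, this is the map `g ↦ g·(xu)` forced by `gx = xg + [g,x]`.
    { toFun := fun f => (LinearMap.mulLeft R (ι R x)).comp f - f.comp (LieAlgebra.ad R L (j x))
      map_add' := fun f g => by ext; simp [-ι_apply, mul_add]; abel
      map_smul' := fun r f => by ext; simp [-ι_apply, smul_sub] }
  map_add' x y := by ext; simp [-ι_apply, add_mul]; abel
  map_smul' r x := by ext; simp [-ι_apply, smul_sub]
  map_lie' {x y} := by
    ext f g
    simp [-ι_apply, LieRing.of_associative_ring_bracket, mul_sub, sub_mul, mul_assoc]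
    abel

theorem homAction_apply (j : N →ₗ⁅R⁆ L) (x : N) (f : L →ₗ[R] UniversalEnvelopingAlgebra R N)
    (g : L) : homAction j x f g = ι R x * f g + f ⁅g, j x⁆ := by
  rw [← lie_skew, map_neg, ← sub_eq_add_neg]
  rfl

/-- The action of `L` on `U(N)`, regarded as the module induced from the character `χ` of the
kernel of the projection `p : L → N`. -/
def inducedAction (j : N →ₗ⁅R⁆ L) (p : L →ₗ[R] N) (χ : L →ₗ[R] R) :
    L →ₗ[R] Module.End R (UniversalEnvelopingAlgebra R N) :=
  -- `u ∈ U(N)` is applied to the starting map `g ↦ p g + χ g`, which prescribes `g·1`; flipping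
  -- turns the result into `g·u`.
  LinearMap.flip ((LinearMap.applyₗ ((ι R).toLinearMap ∘ₗ p +
    (Algebra.linearMap R (UniversalEnvelopingAlgebra R N)) ∘ₗ χ)) ∘ₗ
    (lift R (homAction j)).toLinearMap)

section

variable (j : N →ₗ⁅R⁆ L) (p : L →ₗ[R] N) (χ : L →ₗ[R] R)

theorem inducedAction_one (g : L) :
    inducedAction j p χ g 1 = ι R (p g) + algebraMap R _ (χ g) := by
  simp [-ι_apply, inducedAction]

theorem inducedAction_ι_mul (g : L) (x : N) (u : UniversalEnvelopingAlgebra R N) :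
    inducedAction j p χ g (ι R x * u) =
      ι R x * inducedAction j p χ g u + inducedAction j p χ ⁅g, j x⁆ u := by
  simp only [inducedAction, LinearMap.flip_apply, LinearMap.comp_apply, AlgHom.toLinearMap_apply,
    map_mul, lift_ι_apply]
  exact homAction_apply j x _ g

variable {j p χ}

/-- On `yu` the recursion gives `y(xu) + [x,y]u`, which is `xyu` in `U(N)`. This is what makes `u·1
= u`. -/
theorem inducedAction_apply_of_mem (hp : ∀ x, p (j x) = x) (hχ : ∀ x, χ (j x) = 0) (x : N)
    (u : UniversalEnvelopingAlgebra R N) : inducedAction j p χ (j x) u = ι R x * u := by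
  induction u using induction_ι_mul generalizing x with
  | zero => simp
  | one => rw [inducedAction_one, hp, hχ, map_zero, add_zero, mul_one]
  | add u v hu hv => rw [map_add, hu, hv, mul_add]
  | smul r u hu => rw [map_smul, hu, mul_smul_comm]
  | mul y u hu =>
    rw [inducedAction_ι_mul, ← LieHom.map_lie, hu, hu, LieHom.map_lie,
      LieRing.of_associative_ring_bracket]
    noncomm_ring

/-- The induced action is a representation if the kernel of `p` is a subalgebra on which `χ` is
a character. -/
theorem inducedAction_lie (hp : ∀ x, p (j x) = x) (hχ : ∀ x, χ (j x) = 0)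
    (hker : ∀ g h, p ⁅g - j (p g), h - j (p h)⁆ = 0) (hχker : ∀ g h, χ ⁅g - j (p g), h - j (p h)⁆ = 0)
    (g h : L) (u : UniversalEnvelopingAlgebra R N) :
    inducedAction j p χ ⁅g, h⁆ u = inducedAction j p χ g (inducedAction j p χ h u) -
      inducedAction j p χ h (inducedAction j p χ g u) := by
  -- With one argument in `N`, the bracket relation is the recursion itself.
  have left : ∀ (x : N) (h : L) (u : UniversalEnvelopingAlgebra R N),
      inducedAction j p χ ⁅j x, h⁆ u = inducedAction j p χ (j x) (inducedAction j p χ h u) -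
        inducedAction j p χ h (inducedAction j p χ (j x) u) := by
    intro x h u
    rw [inducedAction_apply_of_mem hp hχ, inducedAction_apply_of_mem hp hχ, inducedAction_ι_mul,
      ← lie_skew, map_neg, LinearMap.neg_apply]
    abel
  induction u using induction_ι_mul generalizing g h with
  | zero => simp
  | one =>
    -- Elements of `ker p` act on `1` by scalars, so their commutator kills `1`; so does their
    -- bracket.
    have base : ∀ g h : L, p g = 0 → p h = 0 → p ⁅g, h⁆ = 0 → χ ⁅g, h⁆ = 0 →
        inducedAction j p χ ⁅g, h⁆ 1 = inducedAction j p χ g (inducedAction j p χ h 1) -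
          inducedAction j p χ h (inducedAction j p χ g 1) := by
      intro g h h1 h2 h3 h4
      simp only [inducedAction_one, h1, h2, h3, h4, map_zero, zero_add, add_zero,
        Algebra.algebraMap_eq_smul_one, map_smul]
      rw [smul_smul, smul_smul, mul_comm, sub_self]
    obtain ⟨x, a, rfl, ha⟩ : ∃ x a, g = j x + a ∧ a = g - j (p g) := ⟨p g, _, by abel, rfl⟩
    obtain ⟨y, b, rfl, hb⟩ : ∃ y b, h = j y + b ∧ b = h - j (p h) := ⟨p h, _, by abel, rfl⟩
    have hpa : p a = 0 := by rw [ha, map_sub, hp, sub_self]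
    have hpb : p b = 0 := by rw [hb, map_sub, hp, sub_self]
    have hab := base a b hpa hpb (by rw [ha, hb]; exact hker _ _) (by rw [ha, hb]; exact hχker _ _)
    have h1 := left x (j y + b) 1
    have h2 := left y a 1
    rw [← lie_skew, map_neg, LinearMap.neg_apply] at h2
    rw [add_lie, lie_add a, map_add, map_add, LinearMap.add_apply, LinearMap.add_apply, h1, hab,
      ← neg_neg (inducedAction j p χ ⁅a, j y⁆ 1), h2]
    simp only [map_add, LinearMap.add_apply]
    abel
  | add u v hu hv => simp only [map_add, hu, hv]; abel
  | smul r u hu => simp only [map_smul, hu, smul_sub]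
  | mul y u hu =>
    -- The Jacobi identity for `g`, `h`, `y`, with the inductive hypothesis also used for the pairs
    -- `(g, [h,y])` and `(h, [g,y])`.
    rw [inducedAction_ι_mul, hu, inducedAction_ι_mul, inducedAction_ι_mul, map_add, map_add,
      inducedAction_ι_mul, inducedAction_ι_mul, lie_lie, map_sub, LinearMap.sub_apply, hu g ⁅h, j y⁆, hu h ⁅g, j y⁆]
    noncomm_ring

/-- The representation of `U(L)` on `U(N)` extending the induced action. -/
def inducedHom (hp : ∀ x, p (j x) = x) (hχ : ∀ x, χ (j x) = 0)
    (hker : ∀ g h, p ⁅g - j (p g), h - j (p h)⁆ = 0)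
    (hχker : ∀ g h, χ ⁅g - j (p g), h - j (p h)⁆ = 0) :
    UniversalEnvelopingAlgebra R L →ₐ[R] Module.End R (UniversalEnvelopingAlgebra R N) :=
  lift R { inducedAction j p χ with
    map_lie' := fun {g h} => LinearMap.ext fun u => inducedAction_lie hp hχ hker hχker g h u }

theorem inducedHom_ι (hp : ∀ x, p (j x) = x) (hχ : ∀ x, χ (j x) = 0)
    (hker : ∀ g h, p ⁅g - j (p g), h - j (p h)⁆ = 0)
    (hχker : ∀ g h, χ ⁅g - j (p g), h - j (p h)⁆ = 0) (g : L) :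
    inducedHom hp hχ hker hχker (ι R g) = inducedAction j p χ g :=
  lift_ι_apply R _ g

/-- The induced action computes the product in `U(L)` modulo a left ideal containing the defining
relations of the induced module. -/
theorem ι_mul_sub_inducedAction_mem (I : Ideal (UniversalEnvelopingAlgebra R L))
    (hI : ∀ g, ι R g - ι R (j (p g)) - algebraMap R _ (χ g) ∈ I) (g : L)
    (u : UniversalEnvelopingAlgebra R N) :
    ι R g * lift R ((ι R).comp j) u - lift R ((ι R).comp j) (inducedAction j p χ g u) ∈ I := by
  induction u using induction_ι_mul generalizing g with
  | zero => simp
  | one =>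
    rw [inducedAction_one, map_add, lift_ι_apply, map_one, mul_one, AlgHom.commutes, ← sub_sub]
    exact hI g
  | add u v hu hv =>
    rw [map_add, map_add, mul_add, map_add, add_sub_add_comm]
    exact I.add_mem (hu g) (hv g)
  | smul r u hu =>
    rw [map_smul, map_smul, mul_smul_comm, map_smul, ← smul_sub]
    exact Submodule.smul_of_tower_mem I r (hu g)
  | mul y u hu =>
    have h : ι R g * ι R (j y) = ι R (j y) * ι R g + ι R ⁅g, j y⁆ := by
      rw [LieHom.map_lie, LieRing.of_associative_ring_bracket]; abel
    have key := I.add_mem (I.mul_mem_left (ι R (j y)) (hu g)) (hu ⁅g, j y⁆)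
    rw [inducedAction_ι_mul, map_add, map_mul, map_mul, lift_ι_apply, LieHom.comp_apply,
      ← mul_assoc, h]
    convert key using 1
    noncomm_ring

end

end UniversalEnvelopingAlgebra

namespace CurrentSl

open UniversalEnvelopingAlgebra LieAlgebra.SpecialLinear

variable {n : ℕ}

/-! ### The triangular decomposition -/

theorem lie_val (x y : G n) : ⁅x, y⁆.val = x.val * y.val - y.val * x.val :=
  sl_bracket _ _ x y

theorem sl_ext {x y : G n} (h : ∀ a b, x.val a b = y.val a b) : x = y :=
  Subtype.ext (Matrix.ext h)

theorem mem_sl {A : Matrix (Fin (n + 1)) (Fin (n + 1)) ℂ} :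
    A ∈ sl (Fin (n + 1)) ℂ ↔ ∑ a, A a a = 0 := Iff.rfl

/-- The strictly lower triangular part of a matrix. -/
def lowerProj (n : ℕ) : G n →ₗ[ℂ] nMinus n where
  toFun x := ⟨⟨Matrix.of fun a b => if b < a then x.val a b else 0, by simp [mem_sl]⟩,
    fun a b h => by simp [not_lt.mpr h]⟩
  map_add' x y := by
    refine Subtype.ext (sl_ext fun a b => ?_)
    change (if b < a then x.val a b + y.val a b else 0) =
      (if b < a then x.val a b else 0) + (if b < a then y.val a b else 0)
    split_ifs <;> simp
  map_smul' c x := by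
    refine Subtype.ext (sl_ext fun a b => ?_)
    change (if b < a then c * x.val a b else 0) = c * (if b < a then x.val a b else 0)
    split_ifs <;> simp

theorem lowerProj_apply (x : G n) (a b : Fin (n + 1)) :
    (lowerProj n x : G n).val a b = if b < a then x.val a b else 0 := rfl

/-- The strictly upper triangular part of a matrix. -/
def upperProj (x : G n) : nPlus n :=
  ⟨⟨Matrix.of fun a b => if a < b then x.val a b else 0, by simp [mem_sl]⟩,
    fun a b h => by simp [not_lt.mpr h]⟩

theorem upperProj_apply (x : G n) (a b : Fin (n + 1)) :
    (upperProj x : G n).val a b = if a < b then x.val a b else 0 := rfl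

/-- The coefficient of the coroot `h_i` in the diagonal part of a matrix. -/
def corootCoeff (i : Fin n) : G n →ₗ[ℂ] ℂ where
  toFun x := ∑ a : Fin (n + 1), if a ≤ i.castSucc then x.val a a else 0
  map_add' x y := by
    rw [← Finset.sum_add_distrib]
    refine Finset.sum_congr rfl fun a _ => ?_
    change (if a ≤ i.castSucc then x.val a a + y.val a a else 0) = _
    split_ifs <;> simp
  map_smul' c x := by
    rw [RingHom.id_apply, smul_eq_mul, Finset.mul_sum]
    refine Finset.sum_congr rfl fun a _ => ?_
    change (if a ≤ i.castSucc then c * x.val a a else 0) = _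
    split_ifs <;> simp

theorem corootCoeff_apply (i : Fin n) (x : G n) :
    corootCoeff i x = ∑ a : Fin (n + 1), if a ≤ i.castSucc then x.val a a else 0 := rfl

theorem corootCoeff_eq_zero {x : G n} (h : ∀ a, x.val a a = 0) (i : Fin n) :
    corootCoeff i x = 0 := by
  simp [corootCoeff_apply, h]

theorem coroot_val (i : Fin n) (a b : Fin (n + 1)) :
    (coroot i).val a b = (if i.castSucc = a ∧ i.castSucc = b then 1 else 0) -
      (if i.succ = a ∧ i.succ = b then 1 else 0) := by
  simp [coroot, Matrix.single_apply]

theorem corootCoeff_coroot (i k : Fin n) : corootCoeff i (coroot k) = if i = k then 1 else 0 := by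
  simp only [corootCoeff_apply, coroot_val, and_self]
  have h : ∀ a : Fin (n + 1), (if a ≤ i.castSucc then
      ((if k.castSucc = a then 1 else 0) - (if k.succ = a then 1 else 0) : ℂ) else 0) =
      (if k.castSucc = a then (if a ≤ i.castSucc then 1 else 0) else 0) -
      (if k.succ = a then (if a ≤ i.castSucc then 1 else 0) else 0) := by
    intro a; split_ifs <;> simp
  rw [Finset.sum_congr rfl fun a _ => h a, Finset.sum_sub_distrib, Finset.sum_ite_eq,
    Finset.sum_ite_eq]
  simp only [Finset.mem_univ, if_true, Fin.castSucc_le_castSucc_iff, Fin.succ_le_castSucc_iff]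
  rcases lt_trichotomy k i with h | rfl | h
  · simp [h.le, h, h.ne']
  · simp
  · simp [h.not_ge, h.not_gt, h.ne]

/-- Abel summation: the coefficient of `h_i` is the partial trace `C (i + 1)`, consecutive partial
traces differ by a diagonal entry, and the last one is zero because the trace is. -/
theorem sum_corootCoeff (x : G n) :
    ∑ i, corootCoeff i x • coroot i = x - (lowerProj n x : G n) - (upperProj x : G n) := by
  let C : ℕ → ℂ := fun m => ∑ b : Fin (n + 1), if (b : ℕ) < m then x.val b b else 0
  have hC0 : C 0 = 0 := by simp [C]
  have hCn : C (n + 1) = 0 := by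
    have := mem_sl.mp x.2
    have h : C (n + 1) = ∑ a, x.val a a := Finset.sum_congr rfl fun b _ => if_pos b.2
    rw [h, this]
  have hC : ∀ a : Fin (n + 1), C (a + 1) - C a = x.val a a := by
    intro a
    simp only [C]
    rw [← Finset.sum_sub_distrib, Finset.sum_eq_single a]
    · simp
    · intro b _ hb
      have : (b : ℕ) ≠ a := fun h => hb (Fin.ext h)
      have h2 : (b : ℕ) < a + 1 ↔ (b : ℕ) < a := by omega
      simp only [h2, sub_self]
    · simp
  have hc : ∀ i : Fin n, corootCoeff i x = C (i + 1) := by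
    intro i
    simp only [corootCoeff_apply, C]
    refine Finset.sum_congr rfl fun b _ => ?_
    have : b ≤ i.castSucc ↔ (b : ℕ) < i + 1 := by
      rw [Fin.le_def, Fin.val_castSucc]; omega
    simp only [this]
  refine sl_ext fun a b => ?_
  have hl : (∑ i, corootCoeff i x • coroot i).val a b =
        ∑ i : Fin n, C (i + 1) * (coroot i).val a b := by
    rw [AddSubmonoidClass.coe_finsetSum, Matrix.sum_apply]
    refine Finset.sum_congr rfl fun i _ => ?_
    rw [← hc]
    rfl
  have hr : (x - (lowerProj n x : G n) - (upperProj x : G n)).val a b =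
      x.val a b - (if b < a then x.val a b else 0) - (if a < b then x.val a b else 0) := rfl
  rw [hl, hr]
  rcases lt_trichotomy a b with h | rfl | h
  · rw [Finset.sum_eq_zero, if_neg h.not_gt, if_pos h, sub_zero, sub_self]
    intro i _
    rw [coroot_val, if_neg, if_neg, sub_self, mul_zero]
    · rintro ⟨rfl, h'⟩; exact h.ne h'
    · rintro ⟨rfl, h'⟩; exact h.ne h'
  · simp only [lt_irrefl, if_false, sub_zero, coroot_val, and_self, mul_sub, Finset.sum_sub_distrib]
    -- Since `C 0 = C (n + 1) = 0`, both sums extend to all `n + 1` diagonal positions.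
    have h1 := Fin.sum_univ_castSucc fun k : Fin (n + 1) => C (k + 1) * if k = a then 1 else 0
    have h2 := Fin.sum_univ_succ fun k : Fin (n + 1) => C k * if k = a then 1 else 0
    simp only [Fin.val_last, hCn, zero_mul, add_zero, Fin.val_castSucc] at h1
    simp only [Fin.val_zero, hC0, zero_mul, zero_add, Fin.val_succ] at h2
    rw [← h1, ← h2, ← hC a]
    simp
  · rw [Finset.sum_eq_zero, if_pos h, if_neg h.not_gt, sub_zero, sub_self]
    intro i _
    rw [coroot_val, if_neg, if_neg, sub_self, mul_zero]
    · rintro ⟨rfl, h'⟩; exact h.ne' h'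
    · rintro ⟨rfl, h'⟩; exact h.ne' h'

theorem triangular_decomposition (x : G n) :
    x = (lowerProj n x : G n) + (upperProj x : G n) + ∑ i, corootCoeff i x • coroot i := by
  rw [sum_corootCoeff]; abel

theorem lowerProj_coe (y : nMinus n) : lowerProj n (y : G n) = y := by
  refine Subtype.ext (sl_ext fun a b => ?_)
  rw [lowerProj_apply]
  split_ifs with h
  · rfl
  · exact (y.2 a b (not_lt.mp h)).symm

theorem lowerProj_eq_zero {x : G n} (h : ∀ a b, b < a → x.val a b = 0) : lowerProj n x = 0 := by
  refine Subtype.ext (sl_ext fun a b => ?_)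
  rw [lowerProj_apply]
  split_ifs with h'
  · exact h a b h'
  · rfl

theorem upperProj_eq_zero {x : G n} (h : ∀ a b, a < b → x.val a b = 0) : (upperProj x : G n) = 0 := by
  refine sl_ext fun a b => ?_
  rw [upperProj_apply]
  split_ifs with h'
  · exact h a b h'
  · rfl

/-- The diagonal of a product of upper triangular matrices is the product of the diagonals, hence
symmetric in the factors. So any functional of the diagonal is a character of the Borel subalgebra.
-/
theorem lie_upper_val {x y : G n} (hx : ∀ a b, b < a → x.val a b = 0)
    (hy : ∀ a b, b < a → y.val a b = 0) (a b : Fin (n + 1)) (hab : b ≤ a) : ⁅x, y⁆.val a b = 0 := by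
  have key : ∀ {x y : G n}, (∀ a b, b < a → x.val a b = 0) → (∀ a b, b < a → y.val a b = 0) →
      (x.val * y.val) a b = if a = b then x.val a a * y.val a a else 0 := by
    intro x y hx hy
    rw [Matrix.mul_apply, Finset.sum_eq_single a]
    · split_ifs with h
      · rw [h]
      · rw [hy a b (lt_of_le_of_ne hab (Ne.symm h)), mul_zero]
    · intro k _ hk
      rcases lt_or_gt_of_ne hk with h | h
      · rw [hx a k h, zero_mul]
      · rw [hy k b (hab.trans_lt h), mul_zero]
    · simp
  rw [lie_val, Matrix.sub_apply, key hx hy, key hy hx, mul_comm, sub_self]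

/-- The linear functional on `𝔤` that extends the weight `λ` by zero on the root spaces. -/
def weight (lam : Fin n → ℕ) : G n →ₗ[ℂ] ℂ := ∑ i, (lam i : ℂ) • corootCoeff i

theorem weight_apply (lam : Fin n → ℕ) (x : G n) :
    weight lam x = ∑ i, (lam i : ℂ) * corootCoeff i x := by
  simp [weight]

theorem weight_coroot (lam : Fin n → ℕ) (i : Fin n) : weight lam (coroot i) = lam i := by
  simp [weight_apply, corootCoeff_coroot]

theorem weight_eq_zero (lam : Fin n → ℕ) {x : G n} (h : ∀ a, x.val a a = 0) :
    weight lam x = 0 := by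
  simp [weight_apply, corootCoeff_eq_zero h]

/-! ### The Verma module of the current algebra -/

/-- The projection `𝔤[t] → 𝔫⁻[t]`. -/
def currentProj (n : ℕ) : Current (G n) →ₗ[ℂ] Current (nMinus n) :=
  LinearMap.lTensor ℂ[X] (lowerProj n)

/-- The functional on `𝔤[t]` that evaluates at `t = 0` and applies the weight. -/
def currentWeight (lam : Fin n → ℕ) : Current (G n) →ₗ[ℂ] ℂ :=
  (TensorProduct.lid ℂ ℂ).toLinearMap ∘ₗ
    TensorProduct.map (Polynomial.lcoeff ℂ 0) (weight lam)

theorem currentProj_tmul (f : ℂ[X]) (x : G n) :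
    currentProj n (f ⊗ₜ x) = f ⊗ₜ lowerProj n x := rfl

theorem currentWeight_tmul (lam : Fin n → ℕ) (f : ℂ[X]) (x : G n) :
    currentWeight lam (f ⊗ₜ x) = f.coeff 0 * weight lam x := rfl

theorem currentIncl_tmul (k : LieSubalgebra ℂ (G n)) (f : ℂ[X]) (x : k) :
    currentIncl k (f ⊗ₜ x) = f ⊗ₜ (x : G n) := rfl

theorem currentIncl_cur (k : LieSubalgebra ℂ (G n)) (x : k) (r : ℕ) :
    currentIncl k (cur x r) = cur (x : G n) r := rfl

theorem currentProj_incl (y : Current (nMinus n)) :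
    currentProj n (currentIncl (nMinus n) y) = y := by
  induction y using TensorProduct.induction_on with
  | zero => simp
  | tmul f x => rw [currentIncl_tmul, currentProj_tmul, lowerProj_coe]
  | add y z hy hz => rw [map_add, map_add, hy, hz]

theorem currentWeight_incl (lam : Fin n → ℕ) (y : Current (nMinus n)) :
    currentWeight lam (currentIncl (nMinus n) y) = 0 := by
  induction y using TensorProduct.induction_on with
  | zero => simp
  | tmul f x =>
    rw [currentIncl_tmul, currentWeight_tmul, weight_eq_zero _ fun a => x.2 a a le_rfl, mul_zero]
  | add y z hy hz => rw [map_add, map_add, hy, hz, add_zero]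

theorem sub_lowerProj_val (x : G n) (a b : Fin (n + 1)) (h : b < a) :
    (x - (lowerProj n x : G n)).val a b = 0 := by
  change x.val a b - (lowerProj n x : G n).val a b = 0
  rw [lowerProj_apply, if_pos h, sub_self]

theorem current_add_lie {L : Type} [LieRing L] [LieAlgebra ℂ L] (x y z : Current L) :
    ⁅x + y, z⁆ = ⁅x, z⁆ + ⁅y, z⁆ := add_lie x y z

theorem current_lie_add {L : Type} [LieRing L] [LieAlgebra ℂ L] (x y z : Current L) :
    ⁅x, y + z⁆ = ⁅x, y⁆ + ⁅x, z⁆ := lie_add x y z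

theorem current_zero_lie {L : Type} [LieRing L] [LieAlgebra ℂ L] (x : Current L) :
    ⁅(0 : Current L), x⁆ = 0 := zero_lie x

theorem current_lie_zero {L : Type} [LieRing L] [LieAlgebra ℂ L] (x : Current L) :
    ⁅x, (0 : Current L)⁆ = 0 := lie_zero x

/-- Subtracting its lower part puts an element in the Borel current algebra, whose brackets are sums
of `f ⊗ x` with `x` strictly upper triangular. Both conditions for the Verma action are checked on
such tensors. -/
theorem lie_sub_proj_induction {P : Current (G n) → Prop} (zero : P 0)
    (add : ∀ x y, P x → P y → P (x + y))
    (tmul : ∀ (f : ℂ[X]) (x : G n), (∀ a b, b ≤ a → x.val a b = 0) → P (f ⊗ₜ x))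
    (g h : Current (G n)) :
    P ⁅g - currentIncl (nMinus n) (currentProj n g), h - currentIncl (nMinus n) (currentProj n h)⁆ := by
  induction g using TensorProduct.induction_on with
  | zero => rw [map_zero, map_zero, sub_zero, current_zero_lie]; exact zero
  | add g g' hg hg' =>
    rw [map_add, map_add, add_sub_add_comm, current_add_lie]
    exact add _ _ hg hg'
  | tmul f x =>
    induction h using TensorProduct.induction_on with
    | zero => rw [map_zero, map_zero, sub_zero, current_lie_zero]; exact zero
    | add h h' hh hh' =>
      rw [map_add, map_add, add_sub_add_comm, current_lie_add]
      exact add _ _ hh hh'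
    | tmul f' x' =>
      rw [currentProj_tmul, currentProj_tmul, currentIncl_tmul, currentIncl_tmul,
        ← TensorProduct.tmul_sub, ← TensorProduct.tmul_sub, LieAlgebra.ExtendScalars.bracket_tmul]
      exact tmul _ _ (lie_upper_val (sub_lowerProj_val x) (sub_lowerProj_val x'))

theorem currentProj_lie (g h : Current (G n)) :
    currentProj n ⁅g - currentIncl (nMinus n) (currentProj n g),
      h - currentIncl (nMinus n) (currentProj n h)⁆ = 0 := by
  refine lie_sub_proj_induction (P := fun z => currentProj n z = 0) (map_zero _)
    (fun x y hx hy => by rw [map_add, hx, hy, add_zero]) (fun f x hx => ?_) g h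
  rw [currentProj_tmul, lowerProj_eq_zero fun a b hab => hx a b hab.le, TensorProduct.tmul_zero]

theorem currentWeight_lie (lam : Fin n → ℕ) (g h : Current (G n)) :
    currentWeight lam ⁅g - currentIncl (nMinus n) (currentProj n g),
      h - currentIncl (nMinus n) (currentProj n h)⁆ = 0 := by
  refine lie_sub_proj_induction (P := fun z => currentWeight lam z = 0) (map_zero _)
    (fun x y hx hy => by rw [map_add, hx, hy, add_zero]) (fun f x hx => ?_) g h
  rw [currentWeight_tmul, weight_eq_zero _ fun a => hx a a le_rfl, mul_zero]

/-- The action of `𝔤[t]` on `𝐔⁻`, identified with the Verma module of highest weight `λ`. -/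
def verma (lam : Fin n → ℕ) : Current (G n) →ₗ[ℂ] Module.End ℂ (UMinus n) :=
  inducedAction (currentIncl (nMinus n)) (currentProj n) (currentWeight lam)

/-- The action of `𝐔` on `𝐔⁻`, identified with the Verma module of highest weight `λ`. -/
def vermaHom (lam : Fin n → ℕ) : U n →ₐ[ℂ] Module.End ℂ (UMinus n) :=
  inducedHom currentProj_incl (currentWeight_incl lam) currentProj_lie (currentWeight_lie lam)

theorem vermaHom_ι (lam : Fin n → ℕ) (g : Current (G n)) :
    vermaHom lam (ι ℂ g) = verma lam g :=
  inducedHom_ι currentProj_incl (currentWeight_incl lam) currentProj_lie (currentWeight_lie lam) g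

theorem verma_incl (lam : Fin n → ℕ) (y : Current (nMinus n)) (u : UMinus n) :
    verma lam (currentIncl (nMinus n) y) u = ι ℂ y * u :=
  inducedAction_apply_of_mem currentProj_incl (currentWeight_incl lam) y u

theorem verma_lie (lam : Fin n → ℕ) (g h : Current (G n)) (u : UMinus n) :
    verma lam ⁅g, h⁆ u = verma lam g (verma lam h u) - verma lam h (verma lam g u) :=
  inducedAction_lie currentProj_incl (currentWeight_incl lam) currentProj_lie
    (currentWeight_lie lam) g h u

theorem verma_one (lam : Fin n → ℕ) (g : Current (G n)) :
    verma lam g 1 = ι ℂ (currentProj n g) + algebraMap ℂ _ (currentWeight lam g) :=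
  inducedAction_one _ _ _ g

theorem verma_ι_mul (lam : Fin n → ℕ) (g : Current (G n)) (y : Current (nMinus n)) (u : UMinus n) :
    verma lam g (ι ℂ y * u) =
      ι ℂ y * verma lam g u + verma lam ⁅g, currentIncl (nMinus n) y⁆ u :=
  inducedAction_ι_mul _ _ _ g y u

theorem vermaHom_inclU (lam : Fin n → ℕ) (u v : UMinus n) :
    vermaHom lam (inclU n u) v = u * v := by
  induction u using induction_ι_mul generalizing v with
  | zero => simp
  | one => simp
  | add u w hu hw => rw [map_add, map_add, LinearMap.add_apply, hu, hw, add_mul]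
  | smul r u hu => rw [map_smul, map_smul, LinearMap.smul_apply, hu, smul_mul_assoc]
  | mul y u hu =>
    rw [map_mul, map_mul, Module.End.mul_apply, hu, inclU, lift_ι_apply, LieHom.comp_apply,
      vermaHom_ι, verma_incl, mul_assoc]

theorem cur_lie {L : Type} [LieRing L] [LieAlgebra ℂ L] (x y : L) (r s : ℕ) :
    ⁅cur x r, cur y s⁆ = cur ⁅x, y⁆ (r + s) := by
  rw [cur, cur, LieAlgebra.ExtendScalars.bracket_tmul, ← pow_add, cur]

theorem cur_add {L : Type} [LieRing L] [LieAlgebra ℂ L] (x y : L) (r : ℕ) :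
    cur (x + y) r = cur x r + cur y r := TensorProduct.tmul_add _ _ _

theorem cur_smul {L : Type} [LieRing L] [LieAlgebra ℂ L] (c : ℂ) (x : L) (r : ℕ) :
    cur (c • x) r = c • cur x r := TensorProduct.tmul_smul _ _ _

theorem cur_zero {L : Type} [LieRing L] [LieAlgebra ℂ L] (r : ℕ) :
    cur (0 : L) r = 0 := TensorProduct.tmul_zero _ _

theorem cur_sum {L : Type} [LieRing L] [LieAlgebra ℂ L] {κ : Type*} (s : Finset κ) (x : κ → L)
    (r : ℕ) : cur (∑ i ∈ s, x i) r = ∑ i ∈ s, cur (x i) r := TensorProduct.tmul_sum _ _ _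

/-- The current algebra is spanned by the elements `x ⊗ t^r`. -/
theorem mem_of_cur_mem {L : Type} [LieRing L] [LieAlgebra ℂ L] (K : Submodule ℂ (Current L))
    (hK : ∀ x r, cur x r ∈ K) (g : Current L) : g ∈ K := by
  induction g using TensorProduct.induction_on with
  | zero => exact K.zero_mem
  | add g h hg hh => exact K.add_mem hg hh
  | tmul f x =>
    induction f using Polynomial.induction_on' with
    | add p q hp hq => rw [TensorProduct.add_tmul]; exact K.add_mem hp hq
    | monomial r c =>
      rw [← Polynomial.smul_X_eq_monomial, ← TensorProduct.smul_tmul']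
      exact K.smul_mem c (hK x r)

/-! ### Generating series of commuting elements -/

section GeneratingSeries

variable {A : Type} [Ring A] [Algebra ℂ A]

open scoped IsMulCommutative in
/-- Evaluation of polynomials at a family of commuting elements of a noncommutative algebra. -/
def commEval (x : ℕ → A) (hx : ∀ i j, x i * x j = x j * x i) : MvPolynomial ℕ ℂ →ₐ[ℂ] A :=
  haveI : IsMulCommutative (Algebra.adjoin ℂ (Set.range x)) :=
    Algebra.isMulCommutative_adjoin ℂ (by rintro _ ⟨i, rfl⟩ _ ⟨j, rfl⟩; exact hx i j)
  (Algebra.adjoin ℂ (Set.range x)).val.comp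
    (MvPolynomial.aeval fun j => ⟨x j, Algebra.subset_adjoin ⟨j, rfl⟩⟩)

open scoped IsMulCommutative in
theorem commEval_X (x : ℕ → A) (hx : ∀ i j, x i * x j = x j * x i) (j : ℕ) :
    commEval x hx (MvPolynomial.X j) = x j := by
  simp [commEval]

/-- The power series `∑ X_{k+m} z^m`. -/
def shiftSeries (k : ℕ) : PowerSeries (MvPolynomial ℕ ℂ) :=
  PowerSeries.mk fun m => MvPolynomial.X (k + m)

/-- The power series `∑ (m+1) X_{k+m} z^m`. -/
def weightedSeries (k : ℕ) : PowerSeries (MvPolynomial ℕ ℂ) :=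
  PowerSeries.mk fun m => (m + 1 : ℕ) • MvPolynomial.X (k + m)

theorem shiftSeries_eq (k : ℕ) :
    shiftSeries k = PowerSeries.C (MvPolynomial.X k) + PowerSeries.X * shiftSeries (k + 1) := by
  ext1 m
  cases m with
  | zero => simp [shiftSeries]
  | succ m =>
    rw [map_add, PowerSeries.coeff_succ_X_mul, PowerSeries.coeff_C, if_neg m.succ_ne_zero, zero_add,
      shiftSeries, shiftSeries, PowerSeries.coeff_mk, PowerSeries.coeff_mk, add_right_comm, add_assoc]

theorem weightedSeries_eq (k : ℕ) :
    weightedSeries k = shiftSeries k + PowerSeries.X * weightedSeries (k + 1) := by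
  ext1 m
  cases m with
  | zero => simp [shiftSeries, weightedSeries]
  | succ m =>
    rw [map_add, PowerSeries.coeff_succ_X_mul, weightedSeries, weightedSeries, shiftSeries,
      PowerSeries.coeff_mk, PowerSeries.coeff_mk, PowerSeries.coeff_mk, add_right_comm k 1, add_assoc k,
      succ_nsmul']

/-- In `∑ z^m S_{k+m}`, with `S_k` the shifted series, the variable `X_{k+m}` appears `m + 1` times.
-/
theorem sum_coeff_shiftSeries_mul (k s : ℕ) (W : PowerSeries (MvPolynomial ℕ ℂ)) :
    ∑ p ∈ Finset.HasAntidiagonal.antidiagonal s, PowerSeries.coeff p.2 (shiftSeries (k + p.1) * W) =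
      PowerSeries.coeff s (weightedSeries k * W) := by
  induction s generalizing k with
  | zero => simp [weightedSeries_eq k, add_mul, mul_assoc]
  | succ s ih =>
    rw [Finset.Nat.sum_antidiagonal_succ, weightedSeries_eq, add_mul, map_add, mul_assoc,
      PowerSeries.coeff_succ_X_mul, ← ih, add_zero]
    simp only [add_assoc, add_comm 1]

/-- The weighted series at `1` is the derivative of `S = shiftSeries 0`, so this is `(S^{r+1})' =
(r+1) S' S^r`. -/
theorem coeff_weightedSeries_one_mul_pow (r s : ℕ) :
    (r + 1) • PowerSeries.coeff s (weightedSeries 1 * shiftSeries 0 ^ r) =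
      (s + 1) • PowerSeries.coeff (s + 1) (shiftSeries 0 ^ (r + 1)) := by
  have h : weightedSeries 1 = PowerSeries.derivative _ (shiftSeries 0) := by
    ext1 m
    rw [PowerSeries.coeff_derivative, weightedSeries, shiftSeries, PowerSeries.coeff_mk,
      PowerSeries.coeff_mk, nsmul_eq_mul, mul_comm, add_comm 1, zero_add]
    push_cast
    rfl
  have h2 := congrArg (PowerSeries.coeff s)
    ((PowerSeries.derivative (MvPolynomial ℕ ℂ)).leibniz_pow (shiftSeries 0) (r + 1))
  rw [PowerSeries.coeff_derivative, map_nsmul, Nat.add_sub_cancel, ← h, smul_eq_mul] at h2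
  rw [mul_comm (weightedSeries 1), ← h2, nsmul_eq_mul, mul_comm]
  push_cast
  rfl

/-- The weighted series at `0` is `S + z S'`, and `z d/dz` multiplies the coefficient of `z^s` by
`s`. -/
theorem coeff_weightedSeries_zero_mul_pow (r s : ℕ) :
    (r + 1) • PowerSeries.coeff s (weightedSeries 0 * shiftSeries 0 ^ r) =
      (r + 1 + s) • PowerSeries.coeff s (shiftSeries 0 ^ (r + 1)) := by
  rw [weightedSeries_eq, add_mul, map_add, ← pow_succ', nsmul_add, add_nsmul _ (r + 1) s]
  congr 1
  cases s with
  | zero => simp [mul_assoc]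
  | succ s =>
    rw [mul_assoc, PowerSeries.coeff_succ_X_mul, zero_add, coeff_weightedSeries_one_mul_pow]

/-- The coefficients of the powers of the generating series, as sums of products of divided
powers. -/
theorem coeff_shiftSeries_pow (r s : ℕ) :
    PowerSeries.coeff s (shiftSeries 0 ^ r) = (r.factorial : ℂ) •
      ∑ b ∈ (Finset.piAntidiag (Finset.univ : Finset (Fin (s + 1))) r).filter
        (fun b => ∑ j : Fin (s + 1), (j : ℕ) * b j = s),
      ∏ j : Fin (s + 1), dividedPow (MvPolynomial.X (j : ℕ) : MvPolynomial ℕ ℂ) (b j) := by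
  -- Truncating modulo `z^{s+1}` keeps the coefficient of `z^s` and leaves a finite sum for the
  -- multinomial theorem.
  let T : PowerSeries (MvPolynomial ℕ ℂ) :=
    ∑ j : Fin (s + 1), PowerSeries.C (MvPolynomial.X (j : ℕ)) * PowerSeries.X ^ (j : ℕ)
  have hT : PowerSeries.coeff s (shiftSeries 0 ^ r) = PowerSeries.coeff s (T ^ r) := by
    rw [← sub_eq_zero, ← map_sub]
    refine PowerSeries.X_pow_dvd_iff.mp ?_ s (Nat.lt_succ_self s)
    refine dvd_trans (PowerSeries.X_pow_dvd_iff.mpr fun m hm => ?_) (sub_dvd_pow_sub_pow _ _ r)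
    rw [map_sub, map_sum, sub_eq_zero, Finset.sum_eq_single (⟨m, hm⟩ : Fin (s + 1))]
    · rw [PowerSeries.coeff_C_mul_X_pow, if_pos rfl, shiftSeries, PowerSeries.coeff_mk, zero_add]
    · intro j _ hj
      rw [PowerSeries.coeff_C_mul_X_pow, if_neg]
      rintro rfl
      exact hj rfl
    · simp
  rw [hT, Finset.sum_pow_eq_sum_piAntidiag, map_sum, Finset.smul_sum, Finset.sum_filter]
  refine Finset.sum_congr rfl fun b hb => ?_
  have hprod : ∏ j : Fin (s + 1), (PowerSeries.C (MvPolynomial.X (j : ℕ) : MvPolynomial ℕ ℂ) *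
      PowerSeries.X ^ (j : ℕ)) ^ b j =
      PowerSeries.C (∏ j : Fin (s + 1), (MvPolynomial.X (j : ℕ) : MvPolynomial ℕ ℂ) ^ b j) *
        PowerSeries.X ^ ∑ j : Fin (s + 1), (j : ℕ) * b j := by
    simp only [mul_pow, Finset.prod_mul_distrib, map_prod, map_pow, ← pow_mul,
      Finset.prod_pow_eq_pow_sum]
  rw [hprod, ← nsmul_eq_mul, map_nsmul, PowerSeries.coeff_C_mul_X_pow]
  by_cases h : ∑ j : Fin (s + 1), (j : ℕ) * b j = s
  · rw [if_pos h.symm, if_pos h]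
    simp only [dividedPow]
    rw [Finset.prod_smul, smul_smul, ← Nat.cast_smul_eq_nsmul ℂ]
    congr 1
    have hspec := Nat.multinomial_spec Finset.univ b
    rw [(Finset.mem_piAntidiag.mp hb).1] at hspec
    rw [← hspec, Nat.cast_mul, Nat.cast_prod, mul_right_comm, ← Finset.prod_mul_distrib,
      Finset.prod_congr rfl fun j _ => mul_inv_cancel₀ (Nat.cast_ne_zero.mpr (b j).factorial_ne_zero),
      Finset.prod_const_one, one_mul]
  · rw [if_neg (Ne.symm h), if_neg h, smul_zero]

variable (x : ℕ → A) (hx : ∀ i j, x i * x j = x j * x i)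

/-- The coefficient of `z^s` of a power series, evaluated at a family of commuting elements. -/
def evalCoeff (s : ℕ) : PowerSeries (MvPolynomial ℕ ℂ) →+ A :=
  (commEval x hx : MvPolynomial ℕ ℂ →+ A).comp
    (PowerSeries.coeff (R := MvPolynomial ℕ ℂ) s).toAddMonoidHom

theorem evalCoeff_apply (s : ℕ) (W : PowerSeries (MvPolynomial ℕ ℂ)) :
    evalCoeff x hx s W = commEval x hx (PowerSeries.coeff s W) := rfl

theorem evalCoeff_one (s : ℕ) : evalCoeff x hx s 1 = if s = 0 then 1 else 0 := by
  rw [evalCoeff_apply, PowerSeries.coeff_one]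
  split_ifs <;> simp

theorem evalCoeff_shiftSeries_mul (k s : ℕ) (W : PowerSeries (MvPolynomial ℕ ℂ)) :
    evalCoeff x hx s (shiftSeries k * W) =
      ∑ p ∈ Finset.HasAntidiagonal.antidiagonal s, x (k + p.1) * evalCoeff x hx p.2 W := by
  simp only [evalCoeff_apply, PowerSeries.coeff_mul, map_sum, map_mul, shiftSeries,
    PowerSeries.coeff_mk, commEval_X]

theorem evalCoeff_shiftSeries_succ_mul (k s : ℕ) (W : PowerSeries (MvPolynomial ℕ ℂ)) :
    evalCoeff x hx s (shiftSeries (k + 1) * W) =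
      evalCoeff x hx (s + 1) (shiftSeries k * W) - x k * evalCoeff x hx (s + 1) W := by
  rw [shiftSeries_eq k, add_mul, map_add, mul_assoc]
  simp only [evalCoeff_apply]
  rw [PowerSeries.coeff_succ_X_mul, PowerSeries.coeff_C_mul, map_mul (commEval x hx),
    commEval_X, add_sub_cancel_left]

theorem sum_evalCoeff_shiftSeries_mul (k s : ℕ) (W : PowerSeries (MvPolynomial ℕ ℂ)) :
    ∑ p ∈ Finset.HasAntidiagonal.antidiagonal s, evalCoeff x hx p.2 (shiftSeries (k + p.1) * W) =
      evalCoeff x hx s (weightedSeries k * W) := by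
  simp only [evalCoeff_apply, ← map_sum, sum_coeff_shiftSeries_mul]

/-- An operator `T` with `T x_j = x_j T - c x_{k+j}` acts on powers of the generating series as
a first-order differential operator. -/
theorem cartan_evalCoeff_pow (T : Module.End ℂ A) (k : ℕ) (c μ : ℂ)
    (hT : ∀ j u, T (x j * u) = x j * T u - c • (x (k + j) * u)) (h1 : T 1 = μ • 1) (r s : ℕ) :
    T (evalCoeff x hx s (shiftSeries 0 ^ r)) = μ • evalCoeff x hx s (shiftSeries 0 ^ r) -
      c • evalCoeff x hx s (r • (shiftSeries k * shiftSeries 0 ^ (r - 1))) := by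
  induction r generalizing s with
  | zero =>
    rw [pow_zero, evalCoeff_one, zero_nsmul, map_zero, smul_zero, sub_zero]
    split_ifs
    · exact h1
    · rw [map_zero, smul_zero]
  | succ r ih =>
    -- The Leibniz rule. At `r = 0` the truncated exponent `r - 1` is harmless because of the factor
    -- `r`.
    have hr : (r + 1) • (shiftSeries k * shiftSeries 0 ^ (r + 1 - 1)) =
        shiftSeries 0 * (r • (shiftSeries k * shiftSeries 0 ^ (r - 1))) +
          shiftSeries k * shiftSeries 0 ^ r := by
      cases r with
      | zero => simp
      | succ r => simp only [Nat.add_sub_cancel, nsmul_eq_mul]; push_cast; ring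
    rw [hr, map_add, pow_succ', evalCoeff_shiftSeries_mul, evalCoeff_shiftSeries_mul,
      evalCoeff_shiftSeries_mul, map_sum]
    simp only [zero_add, hT, ih, mul_sub, mul_smul_comm, Finset.sum_sub_distrib, ← Finset.smul_sum,
      smul_add]
    abel

/-- An operator `T` with `T x_j = x_j T + H_j`, where `H_j` acts as in `cartan_evalCoeff_pow`, acts
on powers of the generating series as a second-order differential operator. -/
theorem raising_evalCoeff_pow (T : Module.End ℂ A) (H : ℕ → Module.End ℂ A) (k : ℕ) (c : ℂ)
    (μ : ℕ → ℂ) (hT : ∀ j u, T (x j * u) = x j * T u + H (k + j) u) (hT1 : T 1 = 0)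
    (hμ : ∀ m, 0 < m → μ m = 0)
    (hH : ∀ m j u, H m (x j * u) = x j * H m u - c • (x (m + j) * u))
    (hH1 : ∀ m, H m 1 = μ m • 1) (r s : ℕ) :
    T (evalCoeff x hx s (shiftSeries 0 ^ r)) =
      μ k • evalCoeff x hx s (r • shiftSeries 0 ^ (r - 1)) -
      c • evalCoeff x hx s (r.choose 2 • (weightedSeries k * shiftSeries 0 ^ (r - 2))) := by
  induction r generalizing s with
  | zero =>
    rw [pow_zero, evalCoeff_one, Nat.choose_zero_succ, zero_nsmul, zero_nsmul, map_zero, smul_zero,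
      smul_zero, sub_zero]
    split_ifs
    · exact hT1
    · rw [map_zero]
  | succ r ih =>
    have hr1 : (r + 1) • (shiftSeries 0 ^ (r + 1 - 1)) =
        shiftSeries 0 * (r • (shiftSeries 0 ^ (r - 1))) + shiftSeries 0 ^ r := by
      cases r with
      | zero => simp
      | succ r => simp only [Nat.add_sub_cancel, nsmul_eq_mul]; push_cast; ring
    -- Pascal's rule for pairs of factors; the binomial coefficient vanishes wherever `r - 2` is
    -- truncated.
    have hr2 : (r + 1).choose 2 • (weightedSeries k * shiftSeries 0 ^ (r + 1 - 2)) =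
        shiftSeries 0 * (r.choose 2 • (weightedSeries k * shiftSeries 0 ^ (r - 2))) +
          r • (weightedSeries k * shiftSeries 0 ^ (r - 1)) := by
      rcases r with _ | _ | r
      · simp
      · simp
      · rw [Nat.choose_succ_succ' (r + 1 + 1) 1, Nat.choose_one_right,
          show r + 1 + 1 + 1 - 2 = r + 1 by omega, show r + 1 + 1 - 2 = r by omega,
          Nat.add_sub_cancel]
        simp only [nsmul_eq_mul]
        push_cast
        ring
    -- Only `p.1 = 0` survives, since `μ` vanishes at positive indices.
    have hsum1 : ∑ p ∈ Finset.HasAntidiagonal.antidiagonal s,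
        μ (k + p.1) • evalCoeff x hx p.2 (shiftSeries 0 ^ r) =
        μ k • evalCoeff x hx s (shiftSeries 0 ^ r) := by
      rw [Finset.sum_eq_single (0, s)]
      · rw [add_zero]
      · rintro ⟨i, j⟩ hij hne
        have : 0 < i := by
          rcases Nat.eq_zero_or_pos i with rfl | h
          · rw [Finset.HasAntidiagonal.mem_antidiagonal, zero_add] at hij
            exact absurd (by rw [← hij]) hne
          · exact h
        rw [hμ _ (by omega), zero_smul]
      · simp
    have hsum2 : ∑ p ∈ Finset.HasAntidiagonal.antidiagonal s, evalCoeff x hx p.2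
        (r • (shiftSeries (k + p.1) * shiftSeries 0 ^ (r - 1))) =
        evalCoeff x hx s (r • (weightedSeries k * shiftSeries 0 ^ (r - 1))) := by
      simp only [← mul_smul_comm]
      exact sum_evalCoeff_shiftSeries_mul x hx k s _
    rw [hr1, hr2, map_add, map_add, pow_succ', evalCoeff_shiftSeries_mul, evalCoeff_shiftSeries_mul,
      evalCoeff_shiftSeries_mul, map_sum]
    simp only [zero_add, hT, ih, mul_sub, mul_smul_comm, Finset.sum_sub_distrib,
      Finset.sum_add_distrib, ← Finset.smul_sum, smul_add,
      cartan_evalCoeff_pow x hx _ _ c _ (hH _) (hH1 _)]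
    rw [hsum1, hsum2]
    abel

end GeneratingSeries

/-! ### Brackets of root vectors -/

/-- The simple root vector `x_i⁺ = E_{i,i+1}`. -/
def simpleRaising (i : Fin n) : G n := single i.castSucc i.succ (Fin.castSucc_lt_succ).ne 1

theorem single_mem_nPlus {a b : Fin (n + 1)} (h : a < b) : single a b h.ne (1 : ℂ) ∈ nPlus n := by
  intro c d hcd
  rw [val_single]
  refine Matrix.single_apply_of_ne _ _ _ _ _ ?_
  rintro ⟨rfl, rfl⟩
  exact absurd h (not_lt.mpr hcd)

theorem simpleRaising_mem (i : Fin n) : simpleRaising i ∈ nPlus n :=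
  single_mem_nPlus Fin.castSucc_lt_succ

theorem xMinus_coe (α : PosRoot n) : (xMinus α : G n) =
    single α.1.2.succ α.1.1.castSucc (Fin.castSucc_lt_succ_iff.mpr α.2).ne' 1 := rfl

/-- The `a`-th diagonal entry of the coroot `h_j`. -/
def diagCoroot (j : Fin n) (a : Fin (n + 1)) : ℂ :=
  (if j.castSucc = a then 1 else 0) - (if j.succ = a then 1 else 0)

theorem coroot_eq_diagonal (j : Fin n) : (coroot j).val = Matrix.diagonal (diagCoroot j) := by
  ext a b
  rw [coroot_val, Matrix.diagonal_apply, diagCoroot]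
  by_cases h : a = b
  · subst h; simp
  · rw [if_neg, if_neg, if_neg h, sub_zero]
    · rintro ⟨rfl, h'⟩; exact h h'
    · rintro ⟨rfl, h'⟩; exact h h'

theorem lie_coroot_val (j : Fin n) (x : G n) (a b : Fin (n + 1)) :
    ⁅coroot j, x⁆.val a b = (diagCoroot j a - diagCoroot j b) * x.val a b := by
  rw [lie_val, Matrix.sub_apply, coroot_eq_diagonal, Matrix.diagonal_mul, Matrix.mul_diagonal]
  ring

theorem lie_coroot_single (j : Fin n) {a b : Fin (n + 1)} (h : a ≠ b) :
    ⁅coroot j, single a b h (1 : ℂ)⁆ = (diagCoroot j a - diagCoroot j b) • single a b h (1 : ℂ) := by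
  refine sl_ext fun c d => ?_
  rw [lie_coroot_val]
  change _ = _ * (single a b h (1 : ℂ)).val c d
  rw [val_single, Matrix.single_apply]
  split_ifs with h'
  · rw [h'.1, h'.2]
  · simp

theorem diagCoroot_castSucc (j : Fin n) : diagCoroot j j.castSucc = 1 := by
  rw [diagCoroot, if_pos rfl, if_neg (Fin.castSucc_lt_succ).ne', sub_zero]

theorem diagCoroot_succ (j : Fin n) : diagCoroot j j.succ = -1 := by
  rw [diagCoroot, if_pos rfl, if_neg (Fin.castSucc_lt_succ).ne, zero_sub]

theorem lie_coroot_simpleRaising (i : Fin n) :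
    ⁅coroot i, simpleRaising i⁆ = (2 : ℂ) • simpleRaising i := by
  rw [simpleRaising, lie_coroot_single, diagCoroot_castSucc, diagCoroot_succ]
  norm_num

theorem lie_single_single {a b c : Fin (n + 1)} (hab : a ≠ b) (hbc : b ≠ c) (hac : a ≠ c) :
    ⁅single a b hab (1 : ℂ), single b c hbc (1 : ℂ)⁆ = single a c hac (1 : ℂ) := by
  refine Subtype.ext ?_
  rw [lie_val, val_single, val_single, val_single, Matrix.single_mul_single_same, mul_one,
    Matrix.single_mul_single_of_ne _ _ _ _ hac.symm, sub_zero]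

theorem lie_single_single_of_ne {a b c d : Fin (n + 1)} (hab : a ≠ b) (hcd : c ≠ d)
    (hbc : b ≠ c) (hda : d ≠ a) :
    ⁅single a b hab (1 : ℂ), single c d hcd (1 : ℂ)⁆ = 0 := by
  refine Subtype.ext ?_
  rw [lie_val, val_single, val_single, Matrix.single_mul_single_of_ne _ _ _ _ hbc,
    Matrix.single_mul_single_of_ne _ _ _ _ hda, sub_zero]
  rfl

theorem lie_simpleRaising_xMinus_self (i : Fin n) :
    ⁅simpleRaising i, (xMinus (simpleRoot i) : G n)⁆ = coroot i := by
  refine Subtype.ext ?_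
  rw [lie_val, xMinus_coe, simpleRaising, coroot, val_singleSubSingle, val_single, val_single]
  simp [simpleRoot]

theorem lie_simpleRaising_xMinus_of_ne {i j : Fin n} (h : i ≠ j) :
    ⁅simpleRaising i, (xMinus (simpleRoot j) : G n)⁆ = 0 :=
  lie_single_single_of_ne _ _ (fun h' => h (Fin.succ_injective _ h'))
    fun h' => h (Fin.castSucc_injective _ h').symm

theorem lie_coroot_nMinus_mem (j : Fin n) (y : nMinus n) : ⁅coroot j, (y : G n)⁆ ∈ nMinus n := by
  intro a b hab
  rw [lie_coroot_val, y.2 a b hab, mul_zero]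

/-- A simple raising operator carries `𝔫⁻` into `𝔫⁻ ⊕ 𝔥`. For this reason stability can be tested on
simple raising operators once the coroots are known to preserve the ideal. -/
theorem lie_simpleRaising_val (i : Fin n) (y : nMinus n) (a b : Fin (n + 1)) (hab : a < b) :
    ⁅simpleRaising i, (y : G n)⁆.val a b = 0 := by
  rw [lie_val, Matrix.sub_apply, simpleRaising, val_single]
  have h1 : (Matrix.single i.castSucc i.succ (1 : ℂ) * (y : G n).val) a b = 0 := by
    by_cases h : a = i.castSucc
    · subst h
      rw [Matrix.single_mul_apply_same, y.2 _ _ (Fin.castSucc_lt_iff_succ_le.mp hab), mul_zero]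
    · rw [Matrix.single_mul_apply_of_ne _ _ _ _ _ h]
  have h2 : ((y : G n).val * Matrix.single i.castSucc i.succ (1 : ℂ)) a b = 0 := by
    by_cases h : b = i.succ
    · subst h
      rw [Matrix.mul_single_apply_same, y.2 _ _ (Fin.le_castSucc_iff.mpr hab), zero_mul]
    · rw [Matrix.mul_single_apply_of_ne _ _ _ _ _ h]
  rw [h1, h2, sub_zero]

/-! ### The simple raising operators and the coroots generate together with `𝔫⁻[t]` -/

theorem upperProj_eq_sum (x : G n) : (upperProj x : G n) =
    ∑ a, ∑ b, if h : a < b then x.val a b • single a b h.ne (1 : ℂ) else 0 := by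
  refine Subtype.ext ?_
  rw [AddSubmonoidClass.coe_finsetSum, Matrix.matrix_eq_sum_single (upperProj x : G n).val]
  refine Finset.sum_congr rfl fun a _ => ?_
  rw [AddSubmonoidClass.coe_finsetSum]
  refine Finset.sum_congr rfl fun b _ => ?_
  rw [upperProj_apply]
  split_ifs with h
  · change _ = x.val a b • Matrix.single a b (1 : ℂ)
    rw [Matrix.smul_single, smul_eq_mul, mul_one]
  · rw [Matrix.single_zero]; rfl

/-- Bracketing with `h_i ⊗ t^r` turns `x_i⁺ ⊗ 1` into `2 x_i⁺ ⊗ t^r`, and iterated brackets of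
simple root vectors reach every positive root vector. -/
theorem eq_top_of_generators (K : LieSubalgebra ℂ (Current (G n)))
    (hlow : ∀ y, currentIncl (nMinus n) y ∈ K) (hcor : ∀ i r, cur (coroot i) r ∈ K)
    (hraise : ∀ i, cur (simpleRaising i) 0 ∈ K) (g : Current (G n)) : g ∈ K := by
  have hraise' : ∀ i r, cur (simpleRaising i) r ∈ K := by
    intro i r
    have h := K.smul_mem (2⁻¹ : ℂ) (K.lie_mem (hcor i r) (hraise i))
    have h' : (2⁻¹ : ℂ) • ⁅cur (coroot i) r, cur (simpleRaising i) 0⁆ = cur (simpleRaising i) r := by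
      rw [cur_lie, lie_coroot_simpleRaising, cur_smul, smul_smul, add_zero]
      norm_num
    exact h' ▸ h
  have hup : ∀ (a b : Fin (n + 1)) (h : a < b) (r : ℕ), cur (single a b h.ne (1 : ℂ)) r ∈ K := by
    intro a b
    induction b using Fin.induction with
    | zero => intro h; exact absurd h (Fin.not_lt_zero a)
    | succ i ih =>
      intro h r
      rcases (Fin.le_castSucc_iff.mpr h).eq_or_lt with rfl | hlt
      · exact hraise' i r
      · have h' := K.lie_mem (ih hlt r) (hraise i)
        have h2 : ⁅cur (single a i.castSucc hlt.ne (1 : ℂ)) r, cur (simpleRaising i) 0⁆ =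
            cur (single a i.succ h.ne (1 : ℂ)) r := by
          rw [cur_lie, simpleRaising, lie_single_single _ _ h.ne, add_zero]
        exact h2 ▸ h'
  refine mem_of_cur_mem K.toSubmodule (fun x r => ?_) g
  rw [triangular_decomposition x, cur_add, cur_add, upperProj_eq_sum, cur_sum, cur_sum]
  refine add_mem (add_mem (hlow (cur (lowerProj n x) r)) (sum_mem fun a _ => ?_))
    (sum_mem fun i _ => ?_)
  · rw [cur_sum]
    refine sum_mem fun b _ => ?_
    split_ifs with h
    · rw [cur_smul]; exact Submodule.smul_mem _ _ (hup a b h r)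
    · rw [cur_zero]; exact zero_mem _
  · rw [cur_smul]; exact Submodule.smul_mem _ _ (hcor i r)

/-! ### Stabilizers of left ideals in the Verma module -/

/-- The subalgebra of `𝔤[t]` that leaves a left ideal of `𝐔⁻` invariant. -/
def vermaStabilizer (lam : Fin n → ℕ) (J : Ideal (UMinus n)) :
    LieSubalgebra ℂ (Current (G n)) where
  carrier := {g | ∀ u ∈ J, verma lam g u ∈ J}
  add_mem' {g h} hg hh u hu := by
    rw [map_add, LinearMap.add_apply]; exact J.add_mem (hg u hu) (hh u hu)
  zero_mem' u _ := by rw [map_zero, LinearMap.zero_apply]; exact J.zero_mem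
  smul_mem' c g hg u hu := by
    rw [map_smul, LinearMap.smul_apply]; exact Submodule.smul_of_tower_mem J c (hg u hu)
  lie_mem' {g h} hg hh u hu := by
    have := J.sub_mem (hg _ (hh u hu)) (hh _ (hg u hu))
    rwa [← verma_lie] at this

theorem incl_mem_vermaStabilizer (lam : Fin n → ℕ) (J : Ideal (UMinus n))
    (y : Current (nMinus n)) : currentIncl (nMinus n) y ∈ vermaStabilizer lam J := by
  intro u hu
  rw [verma_incl]
  exact J.mul_mem_left _ hu

/-- By `g·(yu) = y(g·u) + [g,y]·u`, stability under `g` spreads from generators to the left ideal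
once all `[g,y]` with `y ∈ 𝔫⁻[t]` preserve it. -/
theorem mem_vermaStabilizer_span (lam : Fin n → ℕ) (S : Set (UMinus n)) (g : Current (G n))
    (hS : ∀ u ∈ S, verma lam g u ∈ Ideal.span S)
    (hg : ∀ y, ⁅g, currentIncl (nMinus n) y⁆ ∈ vermaStabilizer lam (Ideal.span S)) :
    g ∈ vermaStabilizer lam (Ideal.span S) := by
  let M : Submodule ℂ (UMinus n) :=
    { carrier := {u | u ∈ Ideal.span S ∧ verma lam g u ∈ Ideal.span S}
      add_mem' := fun {u v} hu hv => ⟨add_mem hu.1 hv.1, by rw [map_add]; exact add_mem hu.2 hv.2⟩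
      zero_mem' := ⟨zero_mem _, by rw [map_zero]; exact zero_mem _⟩
      smul_mem' := fun c u hu => ⟨Submodule.smul_of_tower_mem _ c hu.1, by
        rw [map_smul]; exact Submodule.smul_of_tower_mem _ c hu.2⟩ }
  have hM : ∀ u ∈ Ideal.span S, u ∈ M := by
    intro u hu
    induction hu using Submodule.span_induction with
    | mem u hu => exact ⟨Ideal.subset_span hu, hS u hu⟩
    | zero => exact M.zero_mem
    | add u v _ _ hu hv => exact M.add_mem hu hv
    | smul a u _ hu =>
      refine mul_mem_of_ι_mul_mem M (fun y v hv => ⟨Ideal.mul_mem_left _ _ hv.1, ?_⟩) a hu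
      rw [verma_ι_mul]
      exact add_mem (Ideal.mul_mem_left _ _ hv.2) (hg y v hv.1)
  exact fun u hu => (hM u hu).2

/-- A left ideal of `𝐔⁻` is a submodule of the Verma module as soon as the coroots and the simple
raising operators map its generators into it. -/
theorem vermaStabilizer_span_eq_top (lam : Fin n → ℕ) (S : Set (UMinus n))
    (hcor : ∀ i r, ∀ u ∈ S, verma lam (cur (coroot i) r) u ∈ Ideal.span S)
    (hraise : ∀ i, ∀ u ∈ S, verma lam (cur (simpleRaising i) 0) u ∈ Ideal.span S)
    (g : Current (G n)) : g ∈ vermaStabilizer lam (Ideal.span S) := by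
  have reduce : ∀ (x : G n) (r : ℕ), (∀ (y : nMinus n) s, cur ⁅x, (y : G n)⁆ s ∈ vermaStabilizer lam (Ideal.span S)) →
      ∀ y, ⁅cur x r, currentIncl (nMinus n) y⁆ ∈ vermaStabilizer lam (Ideal.span S) := by
    intro x r h y
    refine mem_of_cur_mem ((vermaStabilizer lam (Ideal.span S)).toSubmodule.comap
      ((LieAlgebra.ad ℂ (Current (G n)) (cur x r)) ∘ₗ (currentIncl (nMinus n)).toLinearMap))
      (fun y s => ?_) y
    change ⁅cur x r, currentIncl (nMinus n) (cur y s)⁆ ∈ vermaStabilizer lam (Ideal.span S)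
    rw [currentIncl_cur, cur_lie]
    exact h y _
  -- Coroots come first: their brackets with `𝔫⁻[t]` stay in `𝔫⁻[t]`, whereas those of raising
  -- operators involve coroots.
  have hcor' : ∀ i r, cur (coroot i) r ∈ vermaStabilizer lam (Ideal.span S) := by
    intro i r
    refine mem_vermaStabilizer_span lam S _ (hcor i r) (reduce _ _ fun y s => ?_)
    exact incl_mem_vermaStabilizer lam (Ideal.span S)
      (cur (⟨_, lie_coroot_nMinus_mem i y⟩ : nMinus n) s)
  refine eq_top_of_generators _ (incl_mem_vermaStabilizer lam _) hcor' (fun i => ?_) g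
  refine mem_vermaStabilizer_span lam S _ (hraise i) (reduce _ _ fun y s => ?_)
  rw [triangular_decomposition ⁅simpleRaising i, (y : G n)⁆,
    upperProj_eq_zero (lie_simpleRaising_val i y), add_zero, cur_add, cur_sum]
  refine add_mem (incl_mem_vermaStabilizer lam (Ideal.span S) (cur (lowerProj n _) s))
    (sum_mem fun j _ => ?_)
  rw [cur_smul]
  exact (vermaStabilizer lam (Ideal.span S)).smul_mem _ (hcor' j s)

/-! ### The action on the elements `𝐱_i⁻(r, s)` -/

theorem xMinusT_mul_comm (i : Fin n) (j k : ℕ) :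
    xMinusT (simpleRoot i) j * xMinusT (simpleRoot i) k =
      xMinusT (simpleRoot i) k * xMinusT (simpleRoot i) j := by
  rw [← sub_eq_zero, ← LieRing.of_associative_ring_bracket]
  simp only [xMinusT]
  rw [← LieHom.map_lie, cur_lie, lie_self, cur_zero, map_zero]

/-- The element `r! 𝐱_i⁻(r, s)`, as a coefficient of a power of a generating series. -/
def garlandCoeff (i : Fin n) (r s : ℕ) : UMinus n :=
  evalCoeff (xMinusT (simpleRoot i)) (xMinusT_mul_comm i) s (shiftSeries 0 ^ r)

theorem garlandCoeff_eq (i : Fin n) (r s : ℕ) :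
    garlandCoeff i r s = (r.factorial : ℂ) • garland i r s := by
  rw [garlandCoeff, evalCoeff_apply, coeff_shiftSeries_pow, map_smul, map_sum, garland]
  congr 1
  refine Finset.sum_congr rfl fun b _ => ?_
  rw [← List.prod_ofFn, map_list_prod, List.map_ofFn]
  congr 2
  funext j
  simp only [Function.comp_apply, dividedPow, map_smul, map_pow, commEval_X]

theorem garlandCoeff_mem_iff (J : Ideal (UMinus n)) (i : Fin n) (r s : ℕ) :
    garlandCoeff i r s ∈ J ↔ garland i r s ∈ J := by
  have hr : (r.factorial : ℂ) ≠ 0 := Nat.cast_ne_zero.mpr r.factorial_ne_zero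
  refine ⟨fun h => ?_, fun h => ?_⟩
  · have := Submodule.smul_of_tower_mem J (r.factorial : ℂ)⁻¹ h
    rwa [garlandCoeff_eq, smul_smul, inv_mul_cancel₀ hr, one_smul] at this
  · rw [garlandCoeff_eq]
    exact Submodule.smul_of_tower_mem J _ h

theorem garlandCoeff_zero_left (i : Fin n) (s : ℕ) :
    garlandCoeff i 0 s = if s = 0 then 1 else 0 := by
  rw [garlandCoeff, pow_zero, evalCoeff_one]

theorem garlandCoeff_zero_right (i : Fin n) (r : ℕ) :
    garlandCoeff i r 0 = xMinusT (simpleRoot i) 0 ^ r := by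
  induction r with
  | zero => rw [garlandCoeff_zero_left, if_pos rfl, pow_zero]
  | succ r ih =>
    rw [garlandCoeff, pow_succ', evalCoeff_shiftSeries_mul, Finset.Nat.antidiagonal_zero,
      Finset.sum_singleton, pow_succ', ← ih, garlandCoeff, zero_add]

theorem verma_cur_xMinus (lam : Fin n → ℕ) (α : PosRoot n) (k : ℕ) (u : UMinus n) :
    verma lam (cur (xMinus α : G n) k) u = xMinusT α k * u := by
  rw [← currentIncl_cur, verma_incl, xMinusT]

theorem verma_cur_xMinusT_mul (lam : Fin n → ℕ) (x : G n) (r : ℕ) (α : PosRoot n) (k : ℕ)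
    (u : UMinus n) : verma lam (cur x r) (xMinusT α k * u) =
      xMinusT α k * verma lam (cur x r) u + verma lam (cur ⁅x, (xMinus α : G n)⁆ (r + k)) u := by
  rw [xMinusT, verma_ι_mul, currentIncl_cur, cur_lie]

theorem currentWeight_cur (lam : Fin n → ℕ) (x : G n) (r : ℕ) :
    currentWeight lam (cur x r) = if r = 0 then weight lam x else 0 := by
  rw [cur, currentWeight_tmul, Polynomial.coeff_X_pow]
  simp only [eq_comm, ite_mul, one_mul, zero_mul]

theorem verma_coroot_one (lam : Fin n → ℕ) (i : Fin n) (r : ℕ) :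
    verma lam (cur (coroot i) r) 1 = (if r = 0 then (lam i : ℂ) else 0) • (1 : UMinus n) := by
  rw [verma_one, currentWeight_cur, weight_coroot, cur, currentProj_tmul,
    lowerProj_eq_zero fun a b hab => ?_, TensorProduct.tmul_zero, map_zero, zero_add,
    Algebra.algebraMap_eq_smul_one]
  rw [coroot_eq_diagonal, Matrix.diagonal_apply_ne _ hab.ne']

theorem verma_nPlus_one (lam : Fin n → ℕ) (x : nPlus n) (r : ℕ) :
    verma lam (cur (x : G n) r) 1 = 0 := by
  rw [verma_one, currentWeight_cur, weight_eq_zero _ fun a => x.2 a a le_rfl, ite_self, map_zero,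
    add_zero, cur, currentProj_tmul, lowerProj_eq_zero fun a b hab => x.2 a b hab.le,
    TensorProduct.tmul_zero, map_zero]

theorem verma_simpleRaising_one (lam : Fin n → ℕ) (i : Fin n) (r : ℕ) :
    verma lam (cur (simpleRaising i) r) 1 = 0 :=
  verma_nPlus_one lam ⟨_, simpleRaising_mem i⟩ r

/-- The value `α(h_j)` of a positive root at a simple coroot. -/
def rootValue (α : PosRoot n) (j : Fin n) : ℂ :=
  diagCoroot j α.1.1.castSucc - diagCoroot j α.1.2.succ

theorem lie_coroot_xMinus (α : PosRoot n) (j : Fin n) :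
    ⁅coroot j, (xMinus α : G n)⁆ = -(rootValue α j) • (xMinus α : G n) := by
  rw [xMinus_coe, lie_coroot_single, rootValue, neg_sub]

theorem verma_coroot_xMinusT_mul (lam : Fin n → ℕ) (j : Fin n) (r : ℕ) (α : PosRoot n) (k : ℕ)
    (u : UMinus n) : verma lam (cur (coroot j) r) (xMinusT α k * u) =
      xMinusT α k * verma lam (cur (coroot j) r) u - rootValue α j • (xMinusT α (r + k) * u) := by
  rw [verma_cur_xMinusT_mul, lie_coroot_xMinus, cur_smul, map_smul, LinearMap.smul_apply,
    verma_cur_xMinus, neg_smul, sub_eq_add_neg]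

theorem verma_coroot_garlandCoeff (lam : Fin n → ℕ) (j i : Fin n) (k r s : ℕ) :
    verma lam (cur (coroot j) k) (garlandCoeff i r s) =
      (if k = 0 then (lam j : ℂ) else 0) • garlandCoeff i r s - rootValue (simpleRoot i) j •
        evalCoeff (xMinusT (simpleRoot i)) (xMinusT_mul_comm i) s
          (r • (shiftSeries k * shiftSeries 0 ^ (r - 1))) :=
  cartan_evalCoeff_pow _ (xMinusT_mul_comm i) _ k _ _
    (fun _ _ => verma_coroot_xMinusT_mul lam j k _ _ _) (verma_coroot_one lam j k) r s

theorem rootValue_simpleRoot_self (i : Fin n) : rootValue (simpleRoot i) i = 2 := by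
  rw [rootValue, simpleRoot, diagCoroot_castSucc, diagCoroot_succ]
  norm_num

theorem verma_simpleRaising_garlandCoeff (lam : Fin n → ℕ) (i : Fin n) (k r s : ℕ) :
    verma lam (cur (simpleRaising i) k) (garlandCoeff i r s) =
      (if k = 0 then (lam i : ℂ) else 0) • evalCoeff (xMinusT (simpleRoot i)) (xMinusT_mul_comm i) s
        (r • shiftSeries 0 ^ (r - 1)) -
      (2 : ℂ) • evalCoeff (xMinusT (simpleRoot i)) (xMinusT_mul_comm i) s
        (r.choose 2 • (weightedSeries k * shiftSeries 0 ^ (r - 2))) := by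
  refine raising_evalCoeff_pow _ (xMinusT_mul_comm i) _ (fun m => verma lam (cur (coroot i) m)) k 2
    (fun m => if m = 0 then (lam i : ℂ) else 0) (fun j u => ?_) (verma_simpleRaising_one lam i k)
    (fun m hm => if_neg hm.ne') (fun m j u => ?_) (verma_coroot_one lam i) r s
  · rw [verma_cur_xMinusT_mul, lie_simpleRaising_xMinus_self]
  · rw [verma_coroot_xMinusT_mul, rootValue_simpleRoot_self]

theorem verma_simpleRaising_garlandCoeff_of_ne (lam : Fin n → ℕ) {i j : Fin n} (h : j ≠ i)
    (k r s : ℕ) : verma lam (cur (simpleRaising j) k) (garlandCoeff i r s) = 0 := by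
  have := cartan_evalCoeff_pow _ (xMinusT_mul_comm i) (verma lam (cur (simpleRaising j) k)) k 0 0
    (fun l u => by rw [verma_cur_xMinusT_mul, lie_simpleRaising_xMinus_of_ne h, cur_zero, map_zero,
      LinearMap.zero_apply, zero_smul, add_zero, sub_zero])
    (by rw [verma_simpleRaising_one, zero_smul]) r s
  rwa [zero_smul, zero_smul, sub_zero] at this

theorem two_smul_choose_smul {M : Type*} [AddCommGroup M] [Module ℂ M] (r : ℕ) (m : M) :
    (2 : ℂ) • ((r + 2).choose 2 • m) = (r + 2) • ((r + 1) • m) := by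
  have h : 2 * (r + 2).choose 2 = (r + 2) * (r + 1) := by
    rw [Nat.choose_two_right, Nat.mul_div_cancel' (Nat.even_mul_pred_self _).two_dvd]
    rfl
  rw [← mul_smul, ← h, mul_smul, ← Nat.cast_smul_eq_nsmul ℂ 2, Nat.cast_ofNat]

/-- The first-order term contributes `(r+1)λ_i` and the second-order term, through `S + z S'`,
contributes `-(r+1)(r+s)`. -/
theorem verma_simpleRaising_zero_garlandCoeff (lam : Fin n → ℕ) (i : Fin n) (r s : ℕ) :
    verma lam (cur (simpleRaising i) 0) (garlandCoeff i (r + 1) s) =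
      ((r + 1) * (lam i - r - s) : ℂ) • garlandCoeff i r s := by
  rw [verma_simpleRaising_garlandCoeff, if_pos rfl, map_nsmul, Nat.add_sub_cancel, ← garlandCoeff]
  rcases r with _ | r
  · rw [Nat.choose_succ_self, zero_nsmul, map_zero, smul_zero, sub_zero, garlandCoeff_zero_left]
    split_ifs with hs
    · simp [hs]
    · simp
  · rw [map_nsmul, two_smul_choose_smul, evalCoeff_apply, show r + 1 + 1 - 2 = r by omega,
      ← map_nsmul (commEval _ _), coeff_weightedSeries_zero_mul_pow, map_nsmul, ← evalCoeff_apply,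
      ← garlandCoeff]
    simp only [← Nat.cast_smul_eq_nsmul ℂ, smul_smul, ← sub_smul]
    congr 1
    push_cast
    ring

/-- At `k = 1` only the second-order term remains, and its series is `S'`. The operator thus trades
`r` for `s` with a nonzero scalar, which is the engine of Garland's identity. -/
theorem verma_simpleRaising_one_garlandCoeff (lam : Fin n → ℕ) (i : Fin n) (r s : ℕ) :
    verma lam (cur (simpleRaising i) 1) (garlandCoeff i (r + 2) s) =
      -((r + 2) * (s + 1) : ℂ) • garlandCoeff i (r + 1) (s + 1) := by
  rw [verma_simpleRaising_garlandCoeff, if_neg one_ne_zero, zero_smul, zero_sub, map_nsmul,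
    two_smul_choose_smul, evalCoeff_apply, Nat.add_sub_cancel, ← map_nsmul (commEval _ _),
    coeff_weightedSeries_one_mul_pow, map_nsmul, ← evalCoeff_apply, ← garlandCoeff]
  simp only [← Nat.cast_smul_eq_nsmul ℂ, smul_smul, neg_smul]
  push_cast
  rfl

theorem garlandCoeff_mem_of_garland_mem {J : Ideal (UMinus n)} {i : Fin n} {m : ℕ}
    (hJ : ∀ r s, 1 ≤ r → 1 + m ≤ r + s → garland i r s ∈ J) {r s : ℕ} (h : 1 + m ≤ r + s) :
    garlandCoeff i r s ∈ J := by
  rcases Nat.eq_zero_or_pos r with rfl | hr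
  · rw [garlandCoeff_zero_left, if_neg (by omega)]; exact J.zero_mem
  · exact (garlandCoeff_mem_iff J i r s).mpr (hJ r s hr h)

/-- From `S_k = x_k + z S_{k+1}`, lowering `k` by one raises `s` by one, which only helps the bound;
the correction is a left multiple of a coefficient of `S^r` still within range. These are the terms
created by `h_j ⊗ t^k`. -/
theorem evalCoeff_shiftSeries_mul_mem {J : Ideal (UMinus n)} {i : Fin n} {m : ℕ}
    (hJ : ∀ r s, 1 ≤ r → 1 + m ≤ r + s → garland i r s ∈ J) (k : ℕ) {r s : ℕ}
    (h : 1 + m ≤ r + 1 + s) :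
    evalCoeff (xMinusT (simpleRoot i)) (xMinusT_mul_comm i) s
      (shiftSeries k * shiftSeries 0 ^ r) ∈ J := by
  induction k generalizing s with
  | zero => rw [← pow_succ']; exact garlandCoeff_mem_of_garland_mem hJ h
  | succ k ih =>
    rw [evalCoeff_shiftSeries_succ_mul]
    exact J.sub_mem (ih (by omega))
      (J.mul_mem_left _ (garlandCoeff_mem_of_garland_mem hJ (by omega)))

theorem verma_coroot_garlandCoeff_mem {lam : Fin n → ℕ} {J : Ideal (UMinus n)} {i : Fin n} {m : ℕ}
    (hJ : ∀ r s, 1 ≤ r → 1 + m ≤ r + s → garland i r s ∈ J) (j : Fin n) (k : ℕ) {r s : ℕ}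
    (h : 1 + m ≤ r + s) : verma lam (cur (coroot j) k) (garlandCoeff i r s) ∈ J := by
  rw [verma_coroot_garlandCoeff]
  refine J.sub_mem (Submodule.smul_of_tower_mem J _ (garlandCoeff_mem_of_garland_mem hJ h))
    (Submodule.smul_of_tower_mem J _ ?_)
  rcases r with _ | r
  · rw [zero_nsmul, map_zero]; exact J.zero_mem
  · rw [map_nsmul]
    exact Submodule.smul_of_tower_mem J _ (evalCoeff_shiftSeries_mul_mem hJ k h)

theorem verma_simpleRaising_garlandCoeff_mem {lam : Fin n → ℕ} {J : Ideal (UMinus n)} {i : Fin n}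
    (hJ : ∀ r s, 1 ≤ r → 1 + lam i ≤ r + s → garland i r s ∈ J) (j : Fin n) {r s : ℕ} (hr : 1 ≤ r)
    (h : 1 + lam i ≤ r + s) : verma lam (cur (simpleRaising j) 0) (garlandCoeff i r s) ∈ J := by
  by_cases hj : j = i
  · subst hj
    obtain ⟨r, rfl⟩ := Nat.exists_eq_add_of_le' hr
    rw [verma_simpleRaising_zero_garlandCoeff]
    by_cases h' : 1 + lam j ≤ r + s
    · exact Submodule.smul_of_tower_mem J _ (garlandCoeff_mem_of_garland_mem hJ h')
    -- The boundary case, where the image is outside the allowed range but its scalar vanishes.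
    · have : lam j = r + s := by omega
      rw [this]
      push_cast
      rw [add_sub_cancel_left, sub_self, mul_zero, zero_smul]
      exact J.zero_mem
  · rw [verma_simpleRaising_garlandCoeff_of_ne lam hj]
    exact J.zero_mem

/-- Garland's identity: a submodule of the Verma module containing `(x_i⁻ ⊗ 1)^{m+1}` contains the
elements `𝐱_i⁻(r, s)` with `r + s > m`. -/
theorem garland_mem_of_pow_mem {lam : Fin n → ℕ} {J : Ideal (UMinus n)}
    (hJ : ∀ g, g ∈ vermaStabilizer lam J) {i : Fin n} {m : ℕ}
    (h : xMinusT (simpleRoot i) 0 ^ (m + 1) ∈ J) {r s : ℕ} (hr : 1 ≤ r) (hrs : 1 + m ≤ r + s) :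
    garland i r s ∈ J := by
  rw [← garlandCoeff_mem_iff]
  induction s generalizing r with
  | zero =>
    rw [garlandCoeff_zero_right, ← Nat.sub_add_cancel (show m + 1 ≤ r by omega), pow_add]
    exact J.mul_mem_left _ h
  | succ s ih =>
    obtain ⟨r, rfl⟩ := Nat.exists_eq_add_of_le' hr
    -- Start from `(r + 2, s)`, which has the same total as the target `(r + 1, s + 1)`.
    have h1 := hJ (cur (simpleRaising i) 1) _ (ih (r := r + 2) (by omega) (by omega))
    rw [verma_simpleRaising_one_garlandCoeff] at h1
    have hne : -((r + 2) * (s + 1) : ℂ) ≠ 0 :=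
      neg_ne_zero.mpr (mul_ne_zero (by exact_mod_cast (Nat.succ_ne_zero (r + 1)))
        (Nat.cast_add_one_ne_zero s))
    have h2 := Submodule.smul_of_tower_mem J (-((r + 2) * (s + 1) : ℂ))⁻¹ h1
    rwa [smul_smul, inv_mul_cancel₀ hne, one_smul] at h2

/-! ### The action on root vectors -/

theorem dominates_iff {β α : PosRoot n} :
    β.Dominates α ↔ β.1.1 ≤ α.1.1 ∧ α.1.2 ≤ β.1.2 := by
  constructor
  · intro h
    have h1 := h α.1.1
    have h2 := h α.1.2
    rw [PosRoot.coeff, PosRoot.coeff, if_pos ⟨le_rfl, α.2⟩] at h1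
    rw [PosRoot.coeff, PosRoot.coeff, if_pos ⟨α.2, le_rfl⟩] at h2
    refine ⟨?_, ?_⟩
    · by_contra hc
      rw [if_neg fun h => hc h.1] at h1
      omega
    · by_contra hc
      rw [if_neg fun h => hc h.2] at h2
      omega
  · rintro ⟨h1, h2⟩ k
    rw [PosRoot.coeff, PosRoot.coeff]
    split_ifs with h3 h4
    · exact le_rfl
    · exact absurd ⟨h1.trans h3.1, h3.2.trans h2⟩ h4
    · exact Nat.zero_le _
    · exact le_rfl

theorem exists_minAbove_eq (ξ : PosRoot n → ℕ) (α : PosRoot n) :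
    ∃ β : PosRoot n, β.Dominates α ∧ minAbove ξ α = ξ β := by
  obtain ⟨β, hβ, h⟩ := Finset.exists_mem_eq_inf'
    (s := Finset.univ.filter fun β : PosRoot n => β.Dominates α)
    ⟨α, Finset.mem_filter.mpr ⟨Finset.mem_univ α, fun _ => le_rfl⟩⟩ ξ
  exact ⟨β, (Finset.mem_filter.mp hβ).2, h⟩

theorem minAbove_le {ξ : PosRoot n → ℕ} {α β : PosRoot n} (h : β.Dominates α) :
    minAbove ξ α ≤ ξ β :=
  Finset.inf'_le ξ (Finset.mem_filter.mpr ⟨Finset.mem_univ β, h⟩)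

theorem minAbove_mono (ξ : PosRoot n → ℕ) {α β : PosRoot n} (h : β.Dominates α) :
    minAbove ξ α ≤ minAbove ξ β := by
  obtain ⟨γ, hγ, hξ⟩ := exists_minAbove_eq ξ β
  rw [hξ]
  exact minAbove_le fun k => (h k).trans (hγ k)

theorem verma_coroot_xMinusT (lam : Fin n → ℕ) (j : Fin n) (r : ℕ) (α : PosRoot n) (k : ℕ) :
    verma lam (cur (coroot j) r) (xMinusT α k) =
      (if r = 0 then (lam j : ℂ) else 0) • xMinusT α k - rootValue α j • xMinusT α (r + k) := by
  have := verma_coroot_xMinusT_mul lam j r α k 1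
  rwa [mul_one, mul_one, verma_coroot_one, mul_smul_comm, mul_one] at this

/-- The value at the left end of the support is `2` for a simple root and `1` otherwise; it is
divided by when the power of `t` is raised. -/
theorem rootValue_left_ne_zero (α : PosRoot n) : rootValue α α.1.1 ≠ 0 := by
  rw [rootValue, diagCoroot_castSucc, diagCoroot,
    if_neg (Fin.castSucc_lt_succ_iff.mpr α.2).ne, zero_sub, sub_neg_eq_add]
  split_ifs <;> norm_num

theorem verma_nPlus_xMinusT (lam : Fin n → ℕ) (x : nPlus n) (r : ℕ) (α : PosRoot n) (k : ℕ) :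
    verma lam (cur (x : G n) r) (xMinusT α k) =
      verma lam (cur ⁅(x : G n), (xMinus α : G n)⁆ (r + k)) 1 := by
  have := verma_cur_xMinusT_mul lam x r α k 1
  rwa [mul_one, verma_nPlus_one, mul_zero, zero_add] at this

/-- The bracket of `x_i⁺` with `x_α⁻` is `h_i` if `α = α_i`, `±x⁻_{α-α_i}` if `α_i` is one end of a
longer `α`, and zero otherwise. Shortening a root can only lower `minAbove`, so the second case
stays in the family. -/
theorem verma_simpleRaising_xMinusT_mem {lam : Fin n → ℕ} {ξ : PosRoot n → ℕ}
    (hξ : ∀ α : PosRoot n, 0 < corootValue lam α → 1 ≤ ξ α) {J : Ideal (UMinus n)}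
    (hJ : ∀ α k, minAbove ξ α ≤ k → xMinusT α k ∈ J) (i : Fin n) {α : PosRoot n} {k : ℕ}
    (hk : minAbove ξ α ≤ k) : verma lam (cur (simpleRaising i) 0) (xMinusT α k) ∈ J := by
  rw [verma_nPlus_xMinusT lam ⟨_, simpleRaising_mem i⟩, zero_add]
  change verma lam (cur ⁅simpleRaising i, (xMinus α : G n)⁆ k) 1 ∈ J
  obtain ⟨⟨p, q⟩, hpq⟩ := α
  change p ≤ q at hpq
  by_cases hq : i = q
  · subst hq
    by_cases hp : p = i
    · subst hp
      change verma lam (cur ⁅simpleRaising p, (xMinus (simpleRoot p) : G n)⁆ k) 1 ∈ J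
      rw [lie_simpleRaising_xMinus_self, verma_coroot_one]
      split_ifs with h0
      -- At `k = 0` some `β ⪰ α_p` has `ξ β = 0`; the condition on `ξ` gives `λ(h_β) = 0`, hence
      -- `lam p = 0`.
      · obtain ⟨β, hβ, hβξ⟩ := exists_minAbove_eq ξ ⟨(p, p), hpq⟩
        have h0' : ξ β = 0 := by omega
        have hval : corootValue lam β = 0 := by
          by_contra hc
          exact absurd (hξ β (Nat.pos_of_ne_zero hc)) (by omega)
        have hlam : lam p = 0 := by
          have h1 := Finset.sum_eq_zero_iff.mp hval p (Finset.mem_univ p)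
          rw [PosRoot.coeff, if_pos (dominates_iff.mp hβ), one_mul] at h1
          exact h1
        rw [hlam, Nat.cast_zero, zero_smul]
        exact J.zero_mem
      · rw [zero_smul]; exact J.zero_mem
    · have hlt : p < i := lt_of_le_of_ne hpq hp
      obtain ⟨q', hq'⟩ : ∃ q' : Fin n, q'.succ = i.castSucc :=
        Fin.exists_succ_eq.mpr (Fin.ne_of_gt (lt_of_le_of_lt (Fin.zero_le p.castSucc) hlt))
      have hpq' : p ≤ q' := by
        rw [← Fin.castSucc_lt_succ_iff, hq']; exact hlt
      have hlie : ⁅simpleRaising i, (xMinus ⟨(p, i), hpq⟩ : G n)⁆ = (xMinus ⟨(p, q'), hpq'⟩ : G n) := by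
        rw [xMinus_coe, xMinus_coe]
        simp only [hq']
        exact lie_single_single _ _ _
      rw [hlie, verma_cur_xMinus, mul_one]
      suffices h : q' ≤ i from hJ _ _ ((minAbove_mono ξ
        (dominates_iff (α := ⟨(p, q'), hpq'⟩) (β := ⟨(p, i), hpq⟩).mpr ⟨le_rfl, h⟩)).trans hk)
      rw [Fin.le_def]
      have := congrArg Fin.val hq'
      rw [Fin.val_succ, Fin.val_castSucc] at this
      omega
  · by_cases hp : p = i
    · subst hp
      have hlt : p < q := lt_of_le_of_ne hpq hq
      obtain ⟨p', hp'⟩ : ∃ p' : Fin n, p'.castSucc = p.succ :=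
        Fin.exists_castSucc_eq.mpr (Fin.ne_of_lt (lt_of_lt_of_le (Fin.succ_lt_succ_iff.mpr hlt)
          (Fin.le_last _)))
      have hpv : (p' : ℕ) = p + 1 := by
        have := congrArg Fin.val hp'
        rwa [Fin.val_succ, Fin.val_castSucc] at this
      have hpq' : p' ≤ q := by rw [Fin.le_def, hpv]; exact hlt
      have hlie : ⁅simpleRaising p, (xMinus ⟨(p, q), hpq⟩ : G n)⁆ =
          -(xMinus ⟨(p', q), hpq'⟩ : G n) := by
        rw [← lie_skew, neg_inj, xMinus_coe, xMinus_coe]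
        simp only [hp']
        exact lie_single_single _ _ _
      rw [hlie, ← neg_one_smul ℂ, cur_smul, map_smul, LinearMap.smul_apply, verma_cur_xMinus, mul_one]
      suffices h : p ≤ p' from Submodule.smul_of_tower_mem J _ (hJ _ _ ((minAbove_mono ξ
        (dominates_iff (α := ⟨(p', q), hpq'⟩) (β := ⟨(p, q), hpq⟩).mpr ⟨h, le_rfl⟩)).trans hk))
      rw [Fin.le_def, hpv]
      omega
    · have hlie : ⁅simpleRaising i, (xMinus ⟨(p, q), hpq⟩ : G n)⁆ = 0 :=
        lie_single_single_of_ne _ _ (fun h => hq (Fin.succ_injective _ h))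
          fun h => hp (Fin.castSucc_injective _ h)
      rw [hlie, cur_zero, map_zero, LinearMap.zero_apply]
      exact J.zero_mem

/-- One positive root vector trims the interval of `β` on the left and another on the right; since
both kill `1`, each acts on the root vector by its bracket alone. -/
theorem xMinusT_mem_of_dominates {lam : Fin n → ℕ} {J : Ideal (UMinus n)}
    (hJ : ∀ g, g ∈ vermaStabilizer lam J) {α β : PosRoot n} (h : β.Dominates α) {k : ℕ}
    (hβ : xMinusT β k ∈ J) : xMinusT α k ∈ J := by
  obtain ⟨h1, h2⟩ := dominates_iff.mp h
  obtain ⟨⟨p, q⟩, hpq⟩ := α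
  obtain ⟨⟨p', q'⟩, hpq'⟩ := β
  change p ≤ q at hpq
  change p' ≤ q' at hpq'
  change p' ≤ p at h1
  change q ≤ q' at h2
  have step1 : xMinusT ⟨(p, q'), hpq.trans h2⟩ k ∈ J := by
    rcases h1.eq_or_lt with rfl | hlt
    · exact hβ
    · have hx := hJ (cur (single p'.castSucc p.castSucc (Fin.castSucc_lt_castSucc_iff.mpr hlt).ne 1) 0)
        _ hβ
      rw [verma_nPlus_xMinusT lam ⟨_, single_mem_nPlus (Fin.castSucc_lt_castSucc_iff.mpr hlt)⟩,
        zero_add] at hx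
      have hlie : ⁅(xMinus ⟨(p', q'), hpq'⟩ : G n), single p'.castSucc p.castSucc
          (Fin.castSucc_lt_castSucc_iff.mpr hlt).ne (1 : ℂ)⁆ =
          (xMinus ⟨(p, q'), hpq.trans h2⟩ : G n) := lie_single_single _ _ _
      rw [← lie_skew, hlie, ← neg_one_smul ℂ, cur_smul, map_smul, LinearMap.smul_apply,
        verma_cur_xMinus, mul_one, neg_one_smul] at hx
      exact neg_mem_iff.mp hx
  rcases h2.eq_or_lt with rfl | hlt
  · exact step1
  · have hx := hJ (cur (single q.succ q'.succ (Fin.succ_lt_succ_iff.mpr hlt).ne 1) 0) _ step1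
    rw [verma_nPlus_xMinusT lam ⟨_, single_mem_nPlus (Fin.succ_lt_succ_iff.mpr hlt)⟩,
      zero_add] at hx
    have hlie : ⁅single q.succ q'.succ (Fin.succ_lt_succ_iff.mpr hlt).ne (1 : ℂ),
        (xMinus ⟨(p, q'), hpq.trans h2⟩ : G n)⁆ = (xMinus ⟨(p, q), hpq⟩ : G n) :=
      lie_single_single _ _ _
    rwa [hlie, verma_cur_xMinus, mul_one] at hx

theorem xMinusT_mem_of_minAbove_le {lam : Fin n → ℕ} {ξ : PosRoot n → ℕ} {J : Ideal (UMinus n)}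
    (hJ : ∀ g, g ∈ vermaStabilizer lam J) (h : ∀ β, xMinusT β (ξ β) ∈ J) {α : PosRoot n} {k : ℕ}
    (hk : minAbove ξ α ≤ k) : xMinusT α k ∈ J := by
  obtain ⟨β, hβ, hξ⟩ := exists_minAbove_eq ξ α
  rw [hξ] at hk
  refine xMinusT_mem_of_dominates hJ hβ ?_
  rcases hk.eq_or_lt with h' | hlt
  · exact h' ▸ h β
  -- As `k - ξ β > 0`, the weight term is absent and a nonzero multiple of `x_β⁻ ⊗ t^k` remains.
  · have hx := hJ (cur (coroot β.1.1) (k - ξ β)) _ (h β)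
    rw [verma_coroot_xMinusT, if_neg (by omega), zero_smul, zero_sub, neg_mem_iff,
      Nat.sub_add_cancel hk] at hx
    have := Submodule.smul_of_tower_mem J (rootValue β β.1.1)⁻¹ hx
    rwa [smul_smul, inv_mul_cancel₀ (rootValue_left_ne_zero β), one_smul] at this

/-! ### The ideals `𝓘` and `𝓙` -/

theorem ι_cur_sub_mem_idealI (ξ : PosRoot n → ℕ) (lam : Fin n → ℕ) (x : G n) (r : ℕ) :
    ι ℂ (cur x r) - ι ℂ (currentIncl (nMinus n) (currentProj n (cur x r))) -
      algebraMap ℂ _ (currentWeight lam (cur x r)) ∈ idealI ξ lam := by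
  have hup : ι ℂ (cur (upperProj x : G n) r) ∈ idealI ξ lam :=
    Ideal.subset_span (Or.inl (Or.inl (Or.inl (Or.inl ⟨cur (upperProj x) r, rfl⟩))))
  have hcor : ∀ i, ι ℂ (cur (coroot i) r) - algebraMap ℂ (U n) (if r = 0 then (lam i : ℂ) else 0) ∈
      idealI ξ lam := by
    intro i
    by_cases h : r = 0
    · rw [if_pos h, h]
      exact Ideal.subset_span (Or.inl (Or.inl (Or.inr ⟨i, rfl⟩)))
    · rw [if_neg h, map_zero, sub_zero]
      exact Ideal.subset_span (Or.inl (Or.inl (Or.inl (Or.inr ⟨i, r, Nat.pos_of_ne_zero h, rfl⟩))))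
  have hx : cur x r = cur (lowerProj n x : G n) r + cur (upperProj x : G n) r +
      ∑ i, corootCoeff i x • cur (coroot i) r := by
    conv_lhs => rw [triangular_decomposition x, cur_add, cur_add, cur_sum]
    simp only [cur_smul]
  have hw : algebraMap ℂ (U n) (currentWeight lam (cur x r)) =
      ∑ i, corootCoeff i x • algebraMap ℂ (U n) (if r = 0 then (lam i : ℂ) else 0) := by
    rw [currentWeight_cur, weight_apply]
    split_ifs
    · rw [map_sum]
      exact Finset.sum_congr rfl fun i _ => by rw [mul_comm, map_mul, Algebra.smul_def]
    · simp
  have hp : currentIncl (nMinus n) (currentProj n (cur x r)) = cur (lowerProj n x : G n) r := rfl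
  have key : ι ℂ (cur x r) - ι ℂ (currentIncl (nMinus n) (currentProj n (cur x r))) -
      algebraMap ℂ _ (currentWeight lam (cur x r)) = ι ℂ (cur (upperProj x : G n) r) +
      ∑ i, corootCoeff i x • (ι ℂ (cur (coroot i) r) -
        algebraMap ℂ (U n) (if r = 0 then (lam i : ℂ) else 0)) := by
    rw [hw, hp, hx, map_add, map_add, map_sum]
    simp only [map_smul, smul_sub, Finset.sum_sub_distrib]
    abel
  rw [key]
  exact add_mem hup (sum_mem fun i _ => Submodule.smul_of_tower_mem _ _ (hcor i))

theorem ι_sub_mem_idealI (ξ : PosRoot n → ℕ) (lam : Fin n → ℕ) (g : Current (G n)) :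
    ι ℂ g - ι ℂ (currentIncl (nMinus n) (currentProj n g)) -
      algebraMap ℂ _ (currentWeight lam g) ∈ idealI ξ lam := by
  let K : Submodule ℂ (Current (G n)) :=
    { carrier := {g | ι ℂ g - ι ℂ (currentIncl (nMinus n) (currentProj n g)) -
        algebraMap ℂ _ (currentWeight lam g) ∈ idealI ξ lam}
      add_mem' := fun {g h} hg hh => by
        have := (idealI ξ lam).add_mem hg hh
        simp only [Set.mem_ofPred_eq, map_add]
        convert this using 1
        abel
      zero_mem' := by simp
      smul_mem' := fun c g hg => by
        have := Submodule.smul_of_tower_mem (idealI ξ lam) c hg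
        simp only [Set.mem_ofPred_eq, map_smul, smul_eq_mul, map_mul]
        rwa [smul_sub, smul_sub, Algebra.smul_def c (algebraMap _ _ _)] at this }
  exact mem_of_cur_mem K (ι_cur_sub_mem_idealI ξ lam) g

/-- For `u ∈ 𝓙`, both `gu` and `gu - g·u` lie in `𝓘`, hence so does `g·u`. -/
theorem mem_vermaStabilizer_idealJ (ξ : PosRoot n → ℕ) (lam : Fin n → ℕ) (g : Current (G n)) :
    g ∈ vermaStabilizer lam (idealJ ξ lam) := by
  intro u hu
  have h := ι_mul_sub_inducedAction_mem (idealI ξ lam) (ι_sub_mem_idealI ξ lam) g u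
  have h' := sub_mem (Ideal.mul_mem_left _ (ι ℂ g) (show inclU n u ∈ idealI ξ lam from hu)) h
  rw [inclU, sub_sub_cancel] at h'
  exact h'

theorem inclU_xMinusT (α : PosRoot n) (k : ℕ) : inclU n (xMinusT α k) = elt (xMinus α : G n) k := by
  rw [inclU, xMinusT, lift_ι_apply]
  rfl

/-- Dividing `𝐔` in two steps amounts to dividing by the sum of the Weyl ideal and the left ideal of
the truncation relations. -/
theorem mem_idealI_iff (ξ : PosRoot n → ℕ) (lam : Fin n → ℕ) (v : U n) :
    v ∈ idealI ξ lam ↔ v • truncGen ξ lam = 0 := by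
  have h1 : v • truncGen ξ lam = Submodule.Quotient.mk (Submodule.Quotient.mk v) := by
    change v • (Submodule.Quotient.mk (Submodule.Quotient.mk 1) : TruncModule ξ lam) = _
    rw [← Submodule.Quotient.mk_smul, ← Submodule.Quotient.mk_smul, smul_eq_mul, mul_one]
  have h2 : (Set.range fun α : PosRoot n => elt (xMinus α : G n) (ξ α) • weylGen lam) =
      (Submodule.span (U n) (weylRelations lam)).mkQ ''
        Set.range fun α : PosRoot n => elt (xMinus α : G n) (ξ α) := by
    rw [← Set.range_comp]
    congr 1
    funext α
    change elt (xMinus α : G n) (ξ α) • Submodule.Quotient.mk 1 = Submodule.Quotient.mk _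
    rw [← Submodule.Quotient.mk_smul, smul_eq_mul, mul_one]
  rw [h1, Submodule.Quotient.mk_eq_zero, h2, Submodule.span_image, ← Submodule.mkQ_apply,
    ← Submodule.mem_comap, Submodule.comap_map_mkQ, ← Submodule.span_union]
  rfl

theorem vermaHom_mem {lam : Fin n → ℕ} {J : Ideal (UMinus n)}
    (hJ : ∀ g, g ∈ vermaStabilizer lam J) (v : U n) {u : UMinus n} (hu : u ∈ J) :
    vermaHom lam v u ∈ J := by
  induction v using induction_ι_mul with
  | zero => rw [map_zero]; exact J.zero_mem
  | one => rwa [map_one]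
  | add v w hv hw => rw [map_add]; exact J.add_mem hv hw
  | smul r v hv => rw [map_smul]; exact Submodule.smul_of_tower_mem J r hv
  | mul g v hv => rw [map_mul, vermaHom_ι]; exact hJ g _ hv

/-- The generators of `𝓘` coming from `𝔫⁺[t]` and `𝔥[t]` kill `1`; the others come from `𝐔⁻` and
send `1` to themselves, which lie in `J`. Stability of `J` handles left multiples. -/
theorem vermaHom_one_mem {ξ : PosRoot n → ℕ} {lam : Fin n → ℕ} {J : Ideal (UMinus n)}
    (hJ : ∀ g, g ∈ vermaStabilizer lam J)
    (hpow : ∀ i, xMinusT (simpleRoot i) 0 ^ (lam i + 1) ∈ J) (hξ : ∀ α, xMinusT α (ξ α) ∈ J)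
    {v : U n} (hv : v ∈ idealI ξ lam) : vermaHom lam v 1 ∈ J := by
  induction hv using Submodule.span_induction with
  | zero => rw [map_zero]; exact J.zero_mem
  | add v w _ _ hv hw => rw [map_add]; exact J.add_mem hv hw
  | smul a v _ hv => rw [smul_eq_mul, map_mul]; exact vermaHom_mem hJ a hv
  | mem v hv =>
    rcases hv with (((⟨y, rfl⟩ | ⟨i, r, hr, rfl⟩) | ⟨i, rfl⟩) | ⟨i, rfl⟩) | ⟨α, rfl⟩
    · dsimp only
      rw [vermaHom_ι]
      refine mem_of_cur_mem ((J.restrictScalars ℂ).comap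
        ((verma lam).flip 1 ∘ₗ (currentIncl (nPlus n)).toLinearMap)) (fun x r => ?_) y
      change verma lam (currentIncl (nPlus n) (cur x r)) 1 ∈ J
      rw [currentIncl_cur, verma_nPlus_one]
      exact J.zero_mem
    · rw [elt, vermaHom_ι, verma_coroot_one, if_neg (by omega), zero_smul]
      exact J.zero_mem
    · rw [map_sub, LinearMap.sub_apply, elt, vermaHom_ι, verma_coroot_one, if_pos rfl,
        AlgHom.commutes, Module.algebraMap_end_apply, sub_self]
      exact J.zero_mem
    · rw [← inclU_xMinusT, ← map_pow, vermaHom_inclU, mul_one]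
      exact hpow i
    · dsimp only
      rw [← inclU_xMinusT, vermaHom_inclU, mul_one]
      exact hξ α

end CurrentSl
end

/-! ### The annihilator and the two inclusions -/

theorem proposition4p3 (n : ℕ) (ξ : CurrentSl.PosRoot n → ℕ) (lam : Fin n → ℕ)
    (hξ : ∀ α : CurrentSl.PosRoot n, 0 < CurrentSl.corootValue lam α → 1 ≤ ξ α) :
    (∀ u : CurrentSl.UMinus n,
      u ∈ CurrentSl.idealJ ξ lam ↔ CurrentSl.inclU n u • CurrentSl.truncGen ξ lam = 0) ∧
    CurrentSl.idealJ ξ lam =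
      Ideal.span
        ({x | ∃ (i : Fin n) (r s : ℕ), 1 ≤ r ∧ 1 + lam i ≤ r + s ∧ x = CurrentSl.garland i r s} ∪
         {x | ∃ (α : CurrentSl.PosRoot n) (k : ℕ),
            CurrentSl.minAbove ξ α ≤ k ∧ x = CurrentSl.xMinusT α k}) := by
  open CurrentSl in
  refine ⟨fun u => mem_idealI_iff ξ lam (inclU n u), ?_⟩
  set S : Set (UMinus n) :=
    {x | ∃ (i : Fin n) (r s : ℕ), 1 ≤ r ∧ 1 + lam i ≤ r + s ∧ x = garland i r s} ∪
      {x | ∃ (α : PosRoot n) (k : ℕ), minAbove ξ α ≤ k ∧ x = xMinusT α k} with hS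
  have hgar : ∀ i r s, 1 ≤ r → 1 + lam i ≤ r + s → garland i r s ∈ Ideal.span S :=
    fun i r s hr h => Ideal.subset_span (Or.inl ⟨i, r, s, hr, h, rfl⟩)
  have hroot : ∀ α k, minAbove ξ α ≤ k → xMinusT α k ∈ Ideal.span S :=
    fun α k hk => Ideal.subset_span (Or.inr ⟨α, k, hk, rfl⟩)
  have hgarEq : ∀ (i : Fin n) (r s : ℕ),
      garland i r s = ((r.factorial : ℂ)⁻¹) • garlandCoeff i r s := by
    intro i r s
    rw [garlandCoeff_eq, smul_smul, inv_mul_cancel₀ (Nat.cast_ne_zero.mpr r.factorial_ne_zero),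
      one_smul]
  have hstab := vermaStabilizer_span_eq_top lam S
    (by
      rintro j m _ (⟨i, r, s, hr, h, rfl⟩ | ⟨α, k, hk, rfl⟩)
      · rw [hgarEq, map_smul]
        exact Submodule.smul_of_tower_mem _ _ (verma_coroot_garlandCoeff_mem (hgar i) j m h)
      · rw [verma_coroot_xMinusT]
        exact sub_mem (Submodule.smul_of_tower_mem _ _ (hroot α k hk))
          (Submodule.smul_of_tower_mem _ _ (hroot α (m + k) (hk.trans (Nat.le_add_left k m)))))
    (by
      rintro j _ (⟨i, r, s, hr, h, rfl⟩ | ⟨α, k, hk, rfl⟩)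
      · rw [hgarEq, map_smul]
        exact Submodule.smul_of_tower_mem _ _ (verma_simpleRaising_garlandCoeff_mem (hgar i) j hr h)
      · exact verma_simpleRaising_xMinusT_mem hξ hroot j hk)
  refine le_antisymm (fun u hu => ?_) (Ideal.span_le.mpr ?_)
  · have h := vermaHom_one_mem hstab (fun i => ?_)
      (fun α => hroot α _ (minAbove_le fun _ => le_rfl)) (show inclU n u ∈ idealI ξ lam from hu)
    · rwa [vermaHom_inclU, mul_one] at h
    -- The power `(x_i⁻ ⊗ 1)^{λ_i+1}` is, up to a factorial, the listed element with `r = λ_i + 1`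
    -- and `s = 0`.
    · rw [← garlandCoeff_zero_right, garlandCoeff_mem_iff]
      exact hgar i _ _ (by omega) (by omega)
  · have hJ := mem_vermaStabilizer_idealJ ξ lam
    rintro _ (⟨i, r, s, hr, h, rfl⟩ | ⟨α, k, hk, rfl⟩)
    · refine garland_mem_of_pow_mem hJ ?_ hr h
      change inclU n _ ∈ idealI ξ lam
      rw [map_pow, inclU_xMinusT]
      exact Ideal.subset_span (Or.inl (Or.inr ⟨i, rfl⟩))
    · refine xMinusT_mem_of_minAbove_le hJ (fun β => ?_) hk
      change inclU n _ ∈ idealI ξ lam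
      rw [inclU_xMinusT]
      exact Ideal.subset_span (Or.inr ⟨β, rfl⟩)
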